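/- For a simple undirected graph $G=(V,E)$ let $B(G)$ be the universal unital C*-algebra generated by unitaries $u_x$, $x\in V$, subject to the relations $u_x^2=1$ for all $x$, $u_xu_y=u_yu_x$ if $x$ and $y$ are not adjacent, and $u_xu_y=-u_yu_x$ if $x$ and $y$ are adjacent. If $V$ is countably infinite, then there are $m,n\in\mathbb N\cup\{\infty\}$ (with $0\in\mathbb N$) and a $*$-isomorphism $$B(G)\cong M_{2^m}(\mathbb C)\otimes \mathbb C^{2^n}.$$ Here $\otimes$ is the C*-tensor product (unambiguous, since the factors are nuclear), $M_{2^\infty}(\mathbb C)$ is the CAR algebra, that is, the C*-algebraic direct limit of the algebras $M_{2^k}(\mathbb C)$ along the embeddings $a\mapsto \operatorname{diag}(a,a)$, and $\mathbb C^{2^\infty}$ is $C(2^{\mathbb N})$, the algebra of continuous complex-valued functions on the Cantor space $2^{\mathbb N}$. -/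

import Mathlib

open scoped TensorProduct ComplexConjugate Matrix.Norms.L2Operator

noncomputable section

/-! ### C⋆-seminorms and the C⋆-algebra obtained by completing -/

/-- A C⋆-seminorm on a complex unital ⋆-algebra. -/
structure CStarSeminorm (R : Type*) [Ring R] [StarRing R] [Algebra ℂ R] extends Seminorm ℂ R where
  mul_le' (a b : R) : toFun (a * b) ≤ toFun a * toFun b
  star_mul_self' (a : R) : toFun (star a * a) = toFun a ^ 2

namespace CStarSeminorm

variable {R : Type*} [Ring R] [StarRing R] [Algebra ℂ R]

instance instFunLike : FunLike (CStarSeminorm R) R ℝ where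
  coe p := p.toSeminorm
  coe_injective p q h := by
    obtain ⟨p, _, _⟩ := p
    obtain ⟨q, _, _⟩ := q
    have : p = q := DFunLike.coe_injective h
    subst this
    rfl

instance instSeminormClass : SeminormClass (CStarSeminorm R) ℂ R where
  map_add_le_add p := map_add_le_add p.toSeminorm
  map_zero p := map_zero p.toSeminorm
  map_neg_eq_map p := map_neg_eq_map p.toSeminorm
  map_smul_eq_mul p := map_smul_eq_mul p.toSeminorm

theorem mul_le (p : CStarSeminorm R) (a b : R) : p (a * b) ≤ p a * p b := p.mul_le' a b

theorem star_mul_self (p : CStarSeminorm R) (a : R) : p (star a * a) = p a ^ 2 :=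
  p.star_mul_self' a

theorem map_star (p : CStarSeminorm R) (a : R) : p (star a) = p a := by
  have key : ∀ b : R, p b ≤ p (star b) := fun b => by
    have h := p.mul_le (star b) b
    rw [p.star_mul_self] at h
    rcases (apply_nonneg p b).eq_or_lt with h0 | h0
    · rw [← h0]; exact apply_nonneg p _
    · nlinarith
  exact le_antisymm (by simpa using key (star a)) (key a)

theorem map_one_le (p : CStarSeminorm R) : p 1 ≤ 1 := by
  have h := p.star_mul_self 1
  rw [star_one, one_mul] at h
  nlinarith [apply_nonneg p (1 : R)]

/-- The ⋆-algebra `R`, equipped with the seminorm `p`. -/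
def Carrier (_p : CStarSeminorm R) : Type _ := R

variable (p : CStarSeminorm R)

instance : Ring p.Carrier := inferInstanceAs (Ring R)
instance : StarRing p.Carrier := inferInstanceAs (StarRing R)
instance : Algebra ℂ p.Carrier := inferInstanceAs (Algebra ℂ R)
instance [StarModule ℂ R] : StarModule ℂ p.Carrier := inferInstanceAs (StarModule ℂ R)

instance : SeminormedRing p.Carrier where
  __ := (inferInstance : Ring p.Carrier)
  __ := AddGroupSeminorm.toSeminormedAddCommGroup (E := p.Carrier)
    { toFun := p
      map_zero' := map_zero p
      add_le' := map_add_le_add p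
      neg' := map_neg_eq_map p }
  norm_mul_le := p.mul_le

instance : NormedSpace ℂ p.Carrier where
  norm_smul_le r a := (map_smul_eq_mul p r a).le

instance : NormedStarGroup p.Carrier where
  norm_star_le a := (p.map_star a).le

/-- The Hausdorff completion of `R` with respect to the C⋆-seminorm `p`: it completes the quotient
of `R` by the null space of `p`. -/
abbrev Completion : Type _ := UniformSpace.Completion p.Carrier

open UniformSpace.Completion in
instance : StarRing p.Completion where
  star := UniformSpace.Completion.map star
  star_involutive a := by
    have hc : Continuous (UniformSpace.Completion.map (star : p.Carrier → p.Carrier)) :=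
      continuous_map
    induction a using UniformSpace.Completion.induction_on with
    | hp => exact isClosed_eq (hc.comp hc) continuous_id
    | ih a =>
      rw [map_coe star_isometry.uniformContinuous, map_coe star_isometry.uniformContinuous,
        star_star]
  star_mul a b := by
    have hc : Continuous (UniformSpace.Completion.map (star : p.Carrier → p.Carrier)) :=
      continuous_map
    induction a, b using UniformSpace.Completion.induction_on₂ with
    | hp =>
      exact isClosed_eq (hc.comp (continuous_fst.mul continuous_snd))
        ((hc.comp continuous_snd).mul (hc.comp continuous_fst))
    | ih a b =>
      rw [← coe_mul, map_coe star_isometry.uniformContinuous,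
        map_coe star_isometry.uniformContinuous, map_coe star_isometry.uniformContinuous,
        star_mul, coe_mul]
  star_add a b := by
    have hc : Continuous (UniformSpace.Completion.map (star : p.Carrier → p.Carrier)) :=
      continuous_map
    induction a, b using UniformSpace.Completion.induction_on₂ with
    | hp =>
      exact isClosed_eq (hc.comp (continuous_fst.add continuous_snd))
        ((hc.comp continuous_fst).add (hc.comp continuous_snd))
    | ih a b =>
      rw [← coe_add, map_coe star_isometry.uniformContinuous,
        map_coe star_isometry.uniformContinuous, map_coe star_isometry.uniformContinuous,
        star_add, coe_add]

theorem star_coe (a : p.Carrier) : star (a : p.Completion) = ((star a : p.Carrier) : p.Completion) :=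
  UniformSpace.Completion.map_coe star_isometry.uniformContinuous a

theorem continuous_star_completion : Continuous (star : p.Completion → p.Completion) :=
  UniformSpace.Completion.continuous_map

instance [StarModule ℂ R] : CStarAlgebra p.Completion where
  norm_smul_le := norm_smul_le
  norm_mul_self_le a := by
    have hc := p.continuous_star_completion
    induction a using UniformSpace.Completion.induction_on with
    | hp =>
      exact isClosed_le (continuous_norm.mul continuous_norm)
        (continuous_norm.comp (hc.mul continuous_id))
    | ih a =>
      rw [star_coe, ← UniformSpace.Completion.coe_mul, UniformSpace.Completion.norm_coe,
        UniformSpace.Completion.norm_coe, ← pow_two]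
      exact (p.star_mul_self a).ge
  star_smul r a := by
    have hc := p.continuous_star_completion
    induction a using UniformSpace.Completion.induction_on with
    | hp =>
      exact isClosed_eq (hc.comp (continuous_const_smul r))
        ((continuous_const_smul (star r)).comp hc)
    | ih a =>
      rw [← UniformSpace.Completion.coe_smul, star_coe, star_coe, star_smul,
        UniformSpace.Completion.coe_smul]

/-- The canonical ⋆-homomorphism from `R` to its completion. -/
def toCompletion : R →⋆ₐ[ℂ] p.Completion where
  toFun a := ((show p.Carrier from a : p.Carrier) : p.Completion)
  map_one' := UniformSpace.Completion.coe_one _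
  map_mul' a b := UniformSpace.Completion.coe_mul (α := p.Carrier) a b
  map_zero' := UniformSpace.Completion.coe_zero
  map_add' a b := UniformSpace.Completion.coe_add (α := p.Carrier) a b
  commutes' _ := rfl
  map_star' a := (p.star_coe a).symm

theorem norm_toCompletion (a : R) : ‖p.toCompletion a‖ = p a :=
  UniformSpace.Completion.norm_coe (E := p.Carrier) a

/-- The pointwise supremum of a pointwise bounded set of C⋆-seminorms. -/
def sup (S : Set (CStarSeminorm R)) (hS : ∀ a, BddAbove ((fun p : CStarSeminorm R => p a) '' S)) :
    CStarSeminorm R where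
  toSeminorm := Seminorm.of (fun a => sSup ((fun p : CStarSeminorm R => p a) '' S))
    (fun a b => by
      refine Real.sSup_le ?_ (add_nonneg ?_ ?_)
      · rintro _ ⟨p, hp, rfl⟩
        exact (map_add_le_add p a b).trans
          (add_le_add (le_csSup (hS a) ⟨p, hp, rfl⟩) (le_csSup (hS b) ⟨p, hp, rfl⟩))
      all_goals
        refine Real.sSup_nonneg ?_
        rintro _ ⟨p, hp, rfl⟩
        exact apply_nonneg p _)
    (fun r a => by
      rw [← smul_eq_mul, ← Real.sSup_smul_of_nonneg (norm_nonneg r)]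
      congr 1
      ext x
      simp only [Set.mem_image, Set.mem_smul_set, exists_exists_and_eq_and, smul_eq_mul]
      simp only [map_smul_eq_mul])
  mul_le' a b := by
    change sSup _ ≤ sSup _ * sSup _
    have h0 : ∀ c : R, 0 ≤ sSup ((fun p : CStarSeminorm R => p c) '' S) := fun c => by
      refine Real.sSup_nonneg ?_
      rintro _ ⟨p, hp, rfl⟩
      exact apply_nonneg p _
    refine Real.sSup_le ?_ (mul_nonneg (h0 a) (h0 b))
    rintro _ ⟨p, hp, rfl⟩
    exact (p.mul_le a b).trans (mul_le_mul (le_csSup (hS a) ⟨p, hp, rfl⟩)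
      (le_csSup (hS b) ⟨p, hp, rfl⟩) (apply_nonneg p _) (h0 a))
  star_mul_self' a := by
    change sSup _ = sSup _ ^ 2
    have h0 : ∀ c : R, 0 ≤ sSup ((fun p : CStarSeminorm R => p c) '' S) := fun c => by
      refine Real.sSup_nonneg ?_
      rintro _ ⟨p, hp, rfl⟩
      exact apply_nonneg p _
    refine le_antisymm (Real.sSup_le ?_ (sq_nonneg _)) ?_
    · rintro _ ⟨p, hp, rfl⟩
      change p (star a * a) ≤ _
      rw [p.star_mul_self]
      exact pow_le_pow_left₀ (apply_nonneg p a) (le_csSup (hS a) ⟨p, hp, rfl⟩) 2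
    · refine (Real.le_sqrt (h0 a) (h0 _)).mp (Real.sSup_le ?_ (Real.sqrt_nonneg _))
      rintro _ ⟨p, hp, rfl⟩
      refine Real.le_sqrt_of_sq_le ?_
      rw [← p.star_mul_self]
      exact le_csSup (hS _) ⟨p, hp, rfl⟩

theorem apply_hom_le [StarModule ℂ R] {A : Type*} [CStarAlgebra A] (φ : A →⋆ₐ[ℂ] R) (a : A) :
    p (φ a) ≤ ‖a‖ := by
  rw [← norm_toCompletion]
  exact NonUnitalStarAlgHom.norm_apply_le (p.toCompletion.comp φ) a

end CStarSeminorm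

/-! ### The free ⋆-algebra -/

/-- The free complex unital ⋆-algebra on `X`: finite linear combinations of words in the letters
`x = (x, false)` and `x⋆ = (x, true)`. -/
def FreeStarAlgebra (X : Type*) : Type _ := MonoidAlgebra ℂ (FreeMonoid (X × Bool))

namespace FreeStarAlgebra

variable {X : Type*}

instance : Ring (FreeStarAlgebra X) :=
  inferInstanceAs (Ring (MonoidAlgebra ℂ (FreeMonoid (X × Bool))))
instance : Algebra ℂ (FreeStarAlgebra X) :=
  inferInstanceAs (Algebra ℂ (MonoidAlgebra ℂ (FreeMonoid (X × Bool))))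

/-- The scalar multiple `r • w` of the word `w`. -/
def term (w : FreeMonoid (X × Bool)) (r : ℂ) : FreeStarAlgebra X := MonoidAlgebra.single w r

/-- The generator attached to `x`. -/
def of (x : X) : FreeStarAlgebra X := term (FreeMonoid.of (x, false)) 1

/-- The adjoint of a word: reverse it and exchange `x` and `x⋆` everywhere. -/
def wordStar (w : FreeMonoid (X × Bool)) : FreeMonoid (X × Bool) :=
  FreeMonoid.ofList ((w.toList.map (fun l => (l.1, !l.2))).reverse)

theorem wordStar_wordStar (w : FreeMonoid (X × Bool)) : wordStar (wordStar w) = w := by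
  apply FreeMonoid.toList.injective
  simp [wordStar, List.map_reverse, Function.comp_def]

theorem wordStar_mul (v w : FreeMonoid (X × Bool)) :
    wordStar (v * w) = wordStar w * wordStar v := by
  apply FreeMonoid.toList.injective
  simp [wordStar]

/-- The adjoint `∑ rᵢ wᵢ ↦ ∑ conj rᵢ wᵢ⋆`. -/
def starAddHom : FreeStarAlgebra X →+ FreeStarAlgebra X where
  toFun a := MonoidAlgebra.ofCoeff
    ((a.coeff.mapDomain wordStar).mapRange (starRingEnd ℂ) (map_zero _))
  map_zero' := by
    change MonoidAlgebra.ofCoeff (Finsupp.mapRange _ _ (Finsupp.mapDomain _ 0)) = 0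
    rw [Finsupp.mapDomain_zero, Finsupp.mapRange_zero]
    rfl
  map_add' a b := by
    change MonoidAlgebra.ofCoeff (Finsupp.mapRange _ _ (Finsupp.mapDomain _ (a.coeff + b.coeff))) = _
    rw [Finsupp.mapDomain_add, Finsupp.mapRange_add (by simp)]
    rfl

theorem starAddHom_term (w : FreeMonoid (X × Bool)) (r : ℂ) :
    starAddHom (term w r) = term (wordStar w) (conj r) := by
  change MonoidAlgebra.ofCoeff (Finsupp.mapRange _ _ (Finsupp.mapDomain _ (Finsupp.single _ _))) = _
  rw [Finsupp.mapDomain_single, Finsupp.mapRange_single]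
  rfl

theorem term_mul_term (v w : FreeMonoid (X × Bool)) (r s : ℂ) :
    term v r * term w s = term (v * w) (r * s) :=
  MonoidAlgebra.single_mul_single ..

theorem induction_term {P : FreeStarAlgebra X → Prop} (a : FreeStarAlgebra X)
    (h0 : P 0) (hadd : ∀ a b, P a → P b → P (a + b)) (hterm : ∀ w r, P (term w r)) : P a := by
  obtain ⟨f⟩ := a
  induction f using Finsupp.induction_linear with
  | zero => exact h0
  | add f g hf hg => exact hadd _ _ hf hg
  | single w r => exact hterm w r

instance : StarRing (FreeStarAlgebra X) where
  star := starAddHom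
  star_add := map_add starAddHom
  star_involutive a := by
    induction a using induction_term with
    | h0 => simp
    | hadd a b ha hb => rw [map_add, map_add, ha, hb]
    | hterm w r => simp [starAddHom_term, wordStar_wordStar]
  star_mul a b := by
    change starAddHom (a * b) = starAddHom b * starAddHom a
    induction a using induction_term with
    | h0 => simp
    | hadd a a' ha ha' => rw [add_mul, map_add, map_add, mul_add, ha, ha']
    | hterm w r =>
      induction b using induction_term with
      | h0 => simp
      | hadd b b' hb hb' => rw [mul_add, map_add, map_add, add_mul, hb, hb']
      | hterm v s =>
        simp [starAddHom_term, term_mul_term, wordStar_mul, mul_comm]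

theorem star_term (w : FreeMonoid (X × Bool)) (r : ℂ) :
    star (term w r) = term (wordStar w) (conj r) := starAddHom_term w r

theorem smul_term (c : ℂ) (w : FreeMonoid (X × Bool)) (r : ℂ) :
    c • term w r = term w (c * r) := MonoidAlgebra.smul_single ..

instance : StarModule ℂ (FreeStarAlgebra X) where
  star_smul c a := by
    induction a using induction_term with
    | h0 => simp
    | hadd a b ha hb => rw [smul_add, star_add, ha, hb, star_add, smul_add]
    | hterm w r => simp [star_term, smul_term]

end FreeStarAlgebra

/-! ### The C⋆-algebra of a graph -/

/-- The defining relations: unitaries of square one, commuting for non-adjacent vertices and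
anticommuting for adjacent vertices. -/
structure SimpleGraph.IsCCRFamily {V : Type*} (G : SimpleGraph V) {A : Type*} [Ring A] [StarRing A]
    (u : V → A) : Prop where
  unitary (x : V) : u x ∈ _root_.unitary A
  sq_eq_one (x : V) : u x ^ 2 = 1
  commute (x y : V) : ¬ G.Adj x y → u x * u y = u y * u x
  anticommute (x y : V) : G.Adj x y → u x * u y = -(u y * u x)

namespace SimpleGraph

variable {V : Type*} (G : SimpleGraph V)

/-- The C⋆-seminorms on the free ⋆-algebra on the vertices in whose completion the generators
satisfy the defining relations. -/
def ccrSeminorms : Set (CStarSeminorm (FreeStarAlgebra V)) :=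
  {p | G.IsCCRFamily fun x => p.toCompletion (FreeStarAlgebra.of x)}

theorem bddAbove_ccrSeminorms (a : FreeStarAlgebra V) :
    BddAbove ((fun p : CStarSeminorm (FreeStarAlgebra V) => p a) '' G.ccrSeminorms) := by
  suffices h : ∃ C, ∀ p ∈ G.ccrSeminorms, p a ≤ C by
    obtain ⟨C, hC⟩ := h
    exact ⟨C, by rintro _ ⟨p, hp, rfl⟩; exact hC p hp⟩
  induction a using FreeStarAlgebra.induction_term with
  | h0 => exact ⟨0, fun p _ => (map_zero p).le⟩
  | hadd a b ha hb =>
    obtain ⟨C, hC⟩ := ha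
    obtain ⟨D, hD⟩ := hb
    exact ⟨C + D, fun p hp => (map_add_le_add p a b).trans (add_le_add (hC p hp) (hD p hp))⟩
  | hterm w r =>
    refine ⟨‖r‖, fun p hp => ?_⟩
    have hle : ∀ x, p (FreeStarAlgebra.of x) ≤ 1 := fun x => by
      have h := p.norm_toCompletion (star (FreeStarAlgebra.of x) * FreeStarAlgebra.of x)
      rw [map_mul, map_star, (Unitary.mem_iff.mp (hp.unitary x)).1, p.star_mul_self,
        ← map_one p.toCompletion, p.norm_toCompletion] at h
      nlinarith [p.map_one_le, apply_nonneg p (FreeStarAlgebra.of x)]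
    have hw : p (FreeStarAlgebra.term w 1) ≤ 1 := by
      induction w using FreeMonoid.recOn with
      | one => exact p.map_one_le
      | of_mul l w hl =>
        have e : FreeStarAlgebra.term (FreeMonoid.of l * w) 1 =
            FreeStarAlgebra.term (FreeMonoid.of l) 1 * FreeStarAlgebra.term w 1 := by
          rw [FreeStarAlgebra.term_mul_term, one_mul]
        rw [e]
        refine (p.mul_le _ _).trans (mul_le_one₀ ?_ (apply_nonneg p _) hl)
        obtain ⟨x, _ | _⟩ := l
        · exact hle x
        · have e' : FreeStarAlgebra.term (FreeMonoid.of (x, true)) 1 =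
              star (FreeStarAlgebra.of x) := by
            rw [FreeStarAlgebra.of, FreeStarAlgebra.star_term, map_one]
            rfl
          rw [e', p.map_star]
          exact hle x
    have e : FreeStarAlgebra.term w r = r • FreeStarAlgebra.term w 1 := by
      rw [FreeStarAlgebra.smul_term, mul_one]
    rw [e, map_smul_eq_mul]
    exact mul_le_of_le_one_right (norm_nonneg r) hw

/-- The universal C⋆-algebra `B(G)` generated by a family of unitaries indexed by the vertices
and subject to the defining relations: the completion of the free ⋆-algebra in the largest
C⋆-seminorm for which the relations hold. -/
abbrev CCRAlgebra : Type _ := (CStarSeminorm.sup G.ccrSeminorms G.bddAbove_ccrSeminorms).Completion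

end SimpleGraph

/-! ### Tensor products of C⋆-algebras -/

theorem bddAbove_tensor (A B : Type*) [CStarAlgebra A] [CStarAlgebra B] (t : A ⊗[ℂ] B) :
    BddAbove ((fun p : CStarSeminorm (A ⊗[ℂ] B) => p t) '' Set.univ) := by
  suffices h : ∃ C, ∀ p : CStarSeminorm (A ⊗[ℂ] B), p t ≤ C by
    obtain ⟨C, hC⟩ := h
    exact ⟨C, by rintro _ ⟨p, _, rfl⟩; exact hC p⟩
  induction t using TensorProduct.induction_on with
  | zero => exact ⟨0, fun p => (map_zero p).le⟩
  | add s t hs ht =>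
    obtain ⟨C, hC⟩ := hs
    obtain ⟨D, hD⟩ := ht
    exact ⟨C + D, fun p => (map_add_le_add p s t).trans (add_le_add (hC p) (hD p))⟩
  | tmul a b =>
    refine ⟨‖a‖ * ‖b‖, fun p => ?_⟩
    let φ : A →⋆ₐ[ℂ] A ⊗[ℂ] B :=
      { (Algebra.TensorProduct.includeLeft : A →ₐ[ℂ] A ⊗[ℂ] B) with
        map_star' := fun a => by simp }
    let ψ : B →⋆ₐ[ℂ] A ⊗[ℂ] B :=
      { (Algebra.TensorProduct.includeRight : B →ₐ[ℂ] A ⊗[ℂ] B) with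
        map_star' := fun a => by simp }
    have e : a ⊗ₜ[ℂ] b = φ a * ψ b := by
      change _ = (a ⊗ₜ[ℂ] (1 : B)) * ((1 : A) ⊗ₜ[ℂ] b)
      simp
    rw [e]
    exact (p.mul_le _ _).trans (mul_le_mul (p.apply_hom_le φ a) (p.apply_hom_le ψ b)
      (apply_nonneg p _) (norm_nonneg a))

/-- The C⋆-tensor product: the completion of the algebraic tensor product in its largest
C⋆-seminorm. When one of the factors is nuclear this is the only C⋆-tensor product. -/
abbrev CStarTensor (A B : Type*) [CStarAlgebra A] [CStarAlgebra B] : Type _ :=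
  (CStarSeminorm.sup Set.univ (bddAbove_tensor A B)).Completion

/-! ### The CAR algebra -/

/-- The remainder modulo `2 ^ i`, as an index of a `2 ^ i × 2 ^ i` matrix. -/
def lowIndex (i : ℕ) {j : ℕ} (x : Fin (2 ^ j)) : Fin (2 ^ i) :=
  ⟨x % 2 ^ i, Nat.mod_lt _ (by positivity)⟩

theorem sum_lowIndex {i j : ℕ} (h : i ≤ j) (x : Fin (2 ^ j)) (f : Fin (2 ^ i) → ℂ) :
    ∑ z : Fin (2 ^ j), (if (x : ℕ) / 2 ^ i = z / 2 ^ i then f (lowIndex i z) else 0) =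
      ∑ w, f w := by
  rw [← Finset.sum_filter]
  have hx : (x : ℕ) / 2 ^ i < 2 ^ (j - i) := by
    rw [Nat.div_lt_iff_lt_mul (by positivity), ← pow_add, Nat.sub_add_cancel h]
    exact x.2
  have hb (w : Fin (2 ^ i)) : 2 ^ i * ((x : ℕ) / 2 ^ i) + w < 2 ^ j := by
    have h2 : 2 ^ j = 2 ^ i * 2 ^ (j - i) := by rw [← pow_add, Nat.add_sub_cancel' h]
    have h3 : 2 ^ i * ((x : ℕ) / 2 ^ i + 1) ≤ 2 ^ i * 2 ^ (j - i) := Nat.mul_le_mul_left _ hx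
    have := w.2
    refine lt_of_lt_of_eq ?_ h2.symm
    linarith
  refine Finset.sum_bij' (fun z _ => lowIndex i z)
    (fun w _ => ⟨2 ^ i * ((x : ℕ) / 2 ^ i) + w, hb w⟩) ?_ ?_ ?_ ?_ ?_
  · simp
  · intro w _
    simp only [Finset.mem_filter, Finset.mem_univ, true_and]
    rw [Nat.mul_add_div (by positivity), Nat.div_eq_of_lt w.2, add_zero]
  · intro z hz
    simp only [Finset.mem_filter, Finset.mem_univ, true_and] at hz
    ext
    simp only [lowIndex, hz]
    exact Nat.div_add_mod _ _
  · intro w _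
    ext
    simp only [lowIndex, Nat.mul_add_mod]
    exact Nat.mod_eq_of_lt w.2
  · intros
    rfl

/-- The block-diagonal embedding `a ↦ diag(a, …, a)` of `M_{2^i}(ℂ)` into `M_{2^j}(ℂ)`. -/
def diagEmb (i j : ℕ) (h : i ≤ j) :
    Matrix (Fin (2 ^ i)) (Fin (2 ^ i)) ℂ →⋆ₐ[ℂ] Matrix (Fin (2 ^ j)) (Fin (2 ^ j)) ℂ where
  toFun a := Matrix.of fun x y =>
    if (x : ℕ) / 2 ^ i = y / 2 ^ i then a (lowIndex i x) (lowIndex i y) else 0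
  map_one' := by
    ext x y
    simp only [Matrix.of_apply, Matrix.one_apply, lowIndex, Fin.ext_iff]
    rw [← ite_and]
    refine if_congr ⟨fun ⟨h1, h2⟩ => ?_, fun h => by simp [h]⟩ rfl rfl
    rw [← Nat.div_add_mod x.1 (2 ^ i), h1, h2, Nat.div_add_mod]
  map_zero' := by ext; simp
  map_mul' a b := by
    ext x y
    simp only [Matrix.of_apply, Matrix.mul_apply]
    by_cases hxy : (x : ℕ) / 2 ^ i = y / 2 ^ i
    · rw [if_pos hxy, ← sum_lowIndex h x]
      refine Finset.sum_congr rfl fun z _ => ?_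
      by_cases hz : (x : ℕ) / 2 ^ i = z / 2 ^ i
      · rw [if_pos hz, if_pos hz, if_pos (hz.symm.trans hxy)]
      · rw [if_neg hz, if_neg hz, zero_mul]
    · rw [if_neg hxy]
      refine (Finset.sum_eq_zero fun z _ => ?_).symm
      by_cases hz : (x : ℕ) / 2 ^ i = z / 2 ^ i
      · rw [if_neg (fun h' => hxy (hz.trans h')), mul_zero]
      · rw [if_neg hz, zero_mul]
  map_add' a b := by
    ext x y
    simp only [Matrix.of_apply, Matrix.add_apply]
    split_ifs <;> simp
  commutes' r := by
    ext x y
    simp only [Matrix.of_apply, Matrix.algebraMap_matrix_apply, lowIndex, Fin.ext_iff]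
    rw [← ite_and]
    refine if_congr ⟨fun ⟨h1, h2⟩ => ?_, fun h => by simp [h]⟩ rfl rfl
    rw [← Nat.div_add_mod x.1 (2 ^ i), h1, h2, Nat.div_add_mod]
  map_star' a := by
    ext x y
    simp only [Matrix.of_apply, Matrix.star_apply, eq_comm (a := (x : ℕ) / 2 ^ i)]
    split_ifs <;> simp

instance : DirectedSystem (fun k : ℕ => Matrix (Fin (2 ^ k)) (Fin (2 ^ k)) ℂ)
    (fun i j h => diagEmb i j h) where
  map_self i a := by
    ext x y
    simp [diagEmb, lowIndex, Nat.div_eq_of_lt x.2, Nat.div_eq_of_lt y.2,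
      Nat.mod_eq_of_lt x.2, Nat.mod_eq_of_lt y.2]
  map_map k j i hij hjk a := by
    ext x y
    have hd : 2 ^ i ∣ 2 ^ j := pow_dvd_pow 2 hij
    have key (z : ℕ) : z % 2 ^ j / 2 ^ i = z / 2 ^ i % 2 ^ (j - i) := by
      rw [← Nat.mod_mul_right_div_self, ← pow_add, Nat.add_sub_cancel' hij]
    have key2 (z : ℕ) : z / 2 ^ j = z / 2 ^ i / 2 ^ (j - i) := by
      rw [Nat.div_div_eq_div_mul, ← pow_add, Nat.add_sub_cancel' hij]
    simp only [diagEmb, lowIndex, StarAlgHom.coe_mk', AlgHom.coe_mk, RingHom.coe_mk,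
      MonoidHom.coe_mk, OneHom.coe_mk, Matrix.of_apply, Nat.mod_mod_of_dvd _ hd]
    rw [← ite_and]
    refine if_congr ⟨fun ⟨h1, h2⟩ => ?_, fun h => ?_⟩ rfl rfl
    · rw [key, key] at h2
      rw [key2, key2] at h1
      rw [← Nat.div_add_mod (x.1 / 2 ^ i) (2 ^ (j - i)), h1, h2, Nat.div_add_mod]
    · rw [key, key, key2, key2, h]
      exact ⟨rfl, rfl⟩

/-- The algebraic direct limit of `M_1(ℂ) → M_2(ℂ) → M_4(ℂ) → ⋯` along `a ↦ diag(a, a)`. -/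
abbrev LocalMatrixAlgebra : Type :=
  DirectLimit (fun k : ℕ => Matrix (Fin (2 ^ k)) (Fin (2 ^ k)) ℂ) (fun i j h => diagEmb i j h)

theorem bddAbove_localMatrixAlgebra (a : LocalMatrixAlgebra) :
    BddAbove ((fun p : CStarSeminorm LocalMatrixAlgebra => p a) '' Set.univ) := by
  induction a using DirectLimit.induction with
  | _ k a =>
  let φ : Matrix (Fin (2 ^ k)) (Fin (2 ^ k)) ℂ →⋆ₐ[ℂ] LocalMatrixAlgebra :=
    { DirectLimit.Algebra.of (fun k : ℕ => Matrix (Fin (2 ^ k)) (Fin (2 ^ k)) ℂ)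
        (fun i j h => diagEmb i j h) k with
      map_star' := fun _ => (DirectLimit.star_def ..).symm }
  exact ⟨‖a‖, by rintro _ ⟨p, _, rfl⟩; exact p.apply_hom_le φ a⟩

/-- The CAR algebra `M_{2^∞}(ℂ)`: the C⋆-algebraic direct limit of the matrix algebras
`M_{2^k}(ℂ)` along the embeddings `a ↦ diag(a, a)`. -/
abbrev CARAlgebra : Type :=
  (CStarSeminorm.sup Set.univ bddAbove_localMatrixAlgebra).Completion

/-! ### The algebras `M_{2^m}(ℂ)` and `ℂ^{2^n}` -/

/-- `M_{2^m}(ℂ)`, the CAR algebra if `m = ∞`. -/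
def MatrixFactor (m : ℕ∞) : Type :=
  ENat.recTopCoe CARAlgebra (fun k => Matrix (Fin (2 ^ k)) (Fin (2 ^ k)) ℂ) m

instance (m : ℕ∞) : CStarAlgebra (MatrixFactor m) :=
  ENat.recTopCoe (C := fun m => CStarAlgebra (MatrixFactor m))
    (inferInstanceAs (CStarAlgebra CARAlgebra))
    (fun k => inferInstanceAs (CStarAlgebra (Matrix (Fin (2 ^ k)) (Fin (2 ^ k)) ℂ))) m

/-- `ℂ^{2^n}`, the algebra of continuous functions on the Cantor space if `n = ∞`. -/
def CommFactor (n : ℕ∞) : Type :=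
  ENat.recTopCoe C(ℕ → Bool, ℂ) (fun k => Fin (2 ^ k) → ℂ) n

instance (n : ℕ∞) : CStarAlgebra (CommFactor n) :=
  ENat.recTopCoe (C := fun n => CStarAlgebra (CommFactor n))
    (inferInstanceAs (CStarAlgebra C(ℕ → Bool, ℂ)))
    (fun k => inferInstanceAs (CStarAlgebra (Fin (2 ^ k) → ℂ))) n

end

/-! ### Homomorphisms out of completions -/

namespace CStarSeminorm

variable {R : Type*} [Ring R] [StarRing R] [Algebra ℂ R]

/-! The algebra depends only on an alternating form over the field with two elements. Let b be the
form on the finitely supported vectors `V →₀ ZMod 2` whose Gram matrix is the adjacency matrix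
(`adjForm`). A word in the generators has an exponent vector in this space; words with exponents w
and w' commute up to the sign (-1)^b(w, w'), and a word with exponent zero is 1 or -1. So every
exponent vector is realised, after multiplying a word by 1 or i, by a unitary of square one
(`IsCCRFamily.exists_symmetry`), and any linear map into this space that preserves the forms turns
generators of one graph algebra into a family satisfying the relations of another graph
(`IsCCRFamily.exists_of_linearMap`). An isometry of forms therefore gives homomorphisms φ and ψ in
both directions. The composite ψφ multiplies each generator by a scalar acting as a sign, hence
squares to the identity, and so does φψ; thus φ is bijective
(`IsUniversalCCR.nonempty_starAlgEquiv`).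

An alternating form of countable dimension has a basis of mutually orthogonal hyperbolic pairs
together with a basis of its radical (`SymplecticBasis.exists_basis`). Hence G may be replaced by a
disjoint union of m edges and n isolated vertices. For such a graph the universal algebra can be
identified: disjoint unions give maximal tensor products (`IsUniversalCCR.tensor`); isolated
vertices give functions on a Cantor cube, by Gelfand duality and Stone–Weierstrass
(`CantorCube.isUniversalCCR_coord`); and an edge gives a pair of Pauli matrices, so that m edges
give the matrix factor (`exists_isUniversalCCR_matrixFactor`).

All identifications go through the universal property `IsUniversalCCR`; neither simplicity of the
matrix factor nor linear independence of monomials is needed. -/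

theorem toCompletion_eq_iff (p : CStarSeminorm R) {a b : R} :
    p.toCompletion a = p.toCompletion b ↔ p (a - b) = 0 := by
  rw [← sub_eq_zero, ← map_sub, ← norm_eq_zero, norm_toCompletion]

theorem denseRange_toCompletion (p : CStarSeminorm R) : DenseRange p.toCompletion :=
  UniformSpace.Completion.denseRange_coe (α := p.Carrier)

theorem dense_adjoin_toCompletion [StarModule ℂ R] (p : CStarSeminorm R) {s : Set R}
    (hs : StarAlgebra.adjoin ℂ s = ⊤) :
    Dense (StarAlgebra.adjoin ℂ (p.toCompletion '' s) : Set p.Completion) := by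
  rw [← StarAlgHom.map_adjoin, hs, StarSubalgebra.coe_map, StarSubalgebra.coe_top, Set.image_univ]
  exact p.denseRange_toCompletion

/-- The C⋆-seminorm `a ↦ ‖Φ a‖` defined by a ⋆-homomorphism `Φ` into a C⋆-algebra. -/
noncomputable def ofHom {C : Type*} [CStarAlgebra C] (Φ : R →⋆ₐ[ℂ] C) : CStarSeminorm R where
  toSeminorm := Seminorm.of (fun a => ‖Φ a‖) (fun a b => by rw [map_add]; exact norm_add_le _ _)
    (fun r a => by rw [map_smul, norm_smul])
  mul_le' a b := by
    change ‖Φ (a * b)‖ ≤ ‖Φ a‖ * ‖Φ b‖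
    rw [map_mul]
    exact norm_mul_le _ _
  star_mul_self' a := by
    change ‖Φ (star a * a)‖ = ‖Φ a‖ ^ 2
    rw [map_mul, StarHomClass.map_star, CStarRing.norm_star_mul_self, sq]

theorem ofHom_apply {C : Type*} [CStarAlgebra C] (Φ : R →⋆ₐ[ℂ] C) (a : R) :
    ofHom Φ a = ‖Φ a‖ := rfl

theorem le_sup {S : Set (CStarSeminorm R)}
    (hS : ∀ a, BddAbove ((fun p : CStarSeminorm R => p a) '' S)) {p : CStarSeminorm R}
    (hp : p ∈ S) (a : R) : p a ≤ sup S hS a :=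
  le_csSup (hS a) ⟨p, hp, rfl⟩

/-- An equation valid in the completion of every member of S is thus valid in the completion of the
supremum, which is how the relations reach `CCRAlgebra`. -/
theorem sup_eq_zero {S : Set (CStarSeminorm R)}
    (hS : ∀ a, BddAbove ((fun p : CStarSeminorm R => p a) '' S)) {a : R}
    (h : ∀ p ∈ S, p a = 0) : sup S hS a = 0 := by
  refine le_antisymm (Real.sSup_le ?_ le_rfl) (apply_nonneg _ _)
  rintro _ ⟨p, hp, rfl⟩
  exact (h p hp).le

/-- A ⋆-homomorphism into a C⋆-algebra which is bounded by a C⋆-seminorm extends to the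
completion. -/
noncomputable def lift (p : CStarSeminorm R) {C : Type*} [CStarAlgebra C] (Φ : R →⋆ₐ[ℂ] C)
    (h : ∀ a, ‖Φ a‖ ≤ p a) : p.Completion →⋆ₐ[ℂ] C :=
  let f : p.Carrier →+* C := Φ.toAlgHom.toRingHom
  have hf : Continuous f := AddMonoidHomClass.continuous_of_bound f 1
    fun a => by rw [one_mul]; exact h a
  { UniformSpace.Completion.extensionHom f hf with
    commutes' := fun r => by
      change UniformSpace.Completion.extensionHom f hf
        ((algebraMap ℂ p.Carrier r : p.Carrier) : p.Completion) = _
      rw [UniformSpace.Completion.extensionHom_coe]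
      exact Φ.toAlgHom.commutes r
    map_star' := fun a => by
      change UniformSpace.Completion.extensionHom f hf (star a) =
        star (UniformSpace.Completion.extensionHom f hf a)
      have hc : Continuous (UniformSpace.Completion.extensionHom f hf) :=
        UniformSpace.Completion.continuous_extension
      induction a using UniformSpace.Completion.induction_on with
      | hp => exact isClosed_eq (hc.comp p.continuous_star_completion) (continuous_star.comp hc)
      | ih a =>
        rw [star_coe, UniformSpace.Completion.extensionHom_coe,
          UniformSpace.Completion.extensionHom_coe]
        exact StarHomClass.map_star Φ a }

theorem lift_toCompletion (p : CStarSeminorm R) {C : Type*} [CStarAlgebra C] (Φ : R →⋆ₐ[ℂ] C)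
    (h : ∀ a, ‖Φ a‖ ≤ p a) (a : R) : p.lift Φ h (p.toCompletion a) = Φ a :=
  UniformSpace.Completion.extensionHom_coe (α := p.Carrier)
    (show p.Carrier →+* C from Φ.toAlgHom.toRingHom)
    (AddMonoidHomClass.continuous_of_bound (show p.Carrier →+* C from Φ.toAlgHom.toRingHom) 1
      fun a => by rw [one_mul]; exact h a) a

end CStarSeminorm

/-! ### Universal families -/

namespace SimpleGraph

/-- Each relation is an equation between images of elements of R, so it passes to any g that
identifies whatever all the f i identify. With f ranging over the admissible seminorms it handles
their supremum; with a single f it handles pushforwards. -/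
theorem IsCCRFamily.of_forall {V : Type*} {G : SimpleGraph V} {R : Type*} [Ring R] [StarRing R]
    [Algebra ℂ R] {ι : Type*} {A : ι → Type*} [∀ i, Ring (A i)] [∀ i, StarRing (A i)]
    [∀ i, Algebra ℂ (A i)] {B : Type*} [Ring B] [StarRing B] [Algebra ℂ B]
    (f : ∀ i, R →⋆ₐ[ℂ] A i) (g : R →⋆ₐ[ℂ] B)
    (hfg : ∀ a b, (∀ i, f i a = f i b) → g a = g b) {w : V → R}
    (h : ∀ i, G.IsCCRFamily fun x => f i (w x)) : G.IsCCRFamily fun x => g (w x) where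
  unitary x := by
    simp_rw [Unitary.mem_iff, ← map_star, ← map_mul, ← map_one g]
    constructor
    · refine hfg _ _ fun i => ?_
      rw [map_mul, map_star, map_one]
      exact (Unitary.mem_iff.mp ((h i).unitary x)).1
    · refine hfg _ _ fun i => ?_
      rw [map_mul, map_star, map_one]
      exact (Unitary.mem_iff.mp ((h i).unitary x)).2
  sq_eq_one x := by
    rw [← map_pow, ← map_one g]
    refine hfg _ _ fun i => ?_
    rw [map_pow, map_one]
    exact (h i).sq_eq_one x
  commute x y hxy := by
    rw [← map_mul, ← map_mul]
    refine hfg _ _ fun i => ?_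
    rw [map_mul, map_mul]
    exact (h i).commute x y hxy
  anticommute x y hxy := by
    rw [← map_mul, ← map_mul, ← map_neg]
    refine hfg _ _ fun i => ?_
    rw [map_neg, map_mul, map_mul]
    exact (h i).anticommute x y hxy

theorem IsCCRFamily.map {V : Type*} {G : SimpleGraph V} {A B : Type*} [Ring A] [StarRing A]
    [Algebra ℂ A] [Ring B] [StarRing B] [Algebra ℂ B] {u : V → A} (h : G.IsCCRFamily u)
    (φ : A →⋆ₐ[ℂ] B) : G.IsCCRFamily fun x => φ (u x) :=
  .of_forall (fun _ : Unit => StarAlgHom.id ℂ A) φ (fun _ _ hab => congrArg φ (hab ()))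
    fun _ => h

/-- `u` is a universal family satisfying the relations of `G`: it generates a C⋆-algebra through
which every other such family in a C⋆-algebra factors. -/
structure IsUniversalCCR.{w, v, u} {V : Type v} (G : SimpleGraph V) {B : Type u} [CStarAlgebra B]
    (u : V → B) : Prop where
  isCCRFamily : G.IsCCRFamily u
  dense : Dense (StarAlgebra.adjoin ℂ (Set.range u) : Set B)
  exists_lift (A : Type w) [CStarAlgebra A] (v : V → A) : G.IsCCRFamily v →
    ∃ φ : B →⋆ₐ[ℂ] A, ∀ x, φ (u x) = v x

end SimpleGraph

/-! ### Extending identities from generators by density -/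

theorem StarAlgHom.continuous_of_cstarAlgebra {A B : Type*} [CStarAlgebra A] [CStarAlgebra B]
    (φ : A →⋆ₐ[ℂ] B) : Continuous φ :=
  AddMonoidHomClass.continuous_of_bound φ 1 fun a => by
    rw [one_mul]
    exact NonUnitalStarAlgHom.norm_apply_le φ a

theorem StarAlgHom.ext_of_dense {A B : Type*} [CStarAlgebra A] [CStarAlgebra B] {s : Set A}
    (hs : Dense (StarAlgebra.adjoin ℂ s : Set A)) {φ ψ : A →⋆ₐ[ℂ] B} (h : s.EqOn φ ψ) : φ = ψ :=
  DFunLike.coe_injective <| Continuous.ext_on hs φ.continuous_of_cstarAlgebra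
    ψ.continuous_of_cstarAlgebra
    fun _ ha => StarAlgHom.adjoin_le_equalizer φ ψ h ha

/-- Centralizers are ⋆-subalgebras and commutation is a closed condition. Membership in a
⋆-centralizer also asks for commutation with the adjoint: in the first stage this is the adjoint of
the relation for `star a`, so s must be self-adjoint; in the second stage a is already arbitrary, so
t need not be. -/
theorem commute_of_dense {A : Type*} {B C : Type*} [CStarAlgebra A] [CStarAlgebra B]
    [CStarAlgebra C] {s : Set A} {t : Set B} (hs : Dense (StarAlgebra.adjoin ℂ s : Set A))
    (ht : Dense (StarAlgebra.adjoin ℂ t : Set B)) (hstar : star s = s) (φ : A →⋆ₐ[ℂ] C)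
    (ψ : B →⋆ₐ[ℂ] C) (h : ∀ a ∈ s, ∀ b ∈ t, Commute (φ a) (ψ b)) (a : A) (b : B) :
    Commute (φ a) (ψ b) := by
  have h1 : ∀ b ∈ t, ∀ a, Commute (φ a) (ψ b) := fun b hb => by
    have hb' : ∀ a ∈ StarAlgebra.adjoin ℂ s, φ a * ψ b = ψ b * φ a := fun a ha => by
      have : StarAlgebra.adjoin ℂ s ≤ (StarSubalgebra.centralizer ℂ {ψ b}).comap φ := by
        refine StarAlgebra.adjoin_le fun a ha => ?_
        rw [SetLike.mem_coe, StarSubalgebra.mem_comap, StarSubalgebra.mem_centralizer_iff]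
        rintro _ rfl
        refine ⟨(h a ha b hb).eq.symm, ?_⟩
        have ha' : star a ∈ s := by rw [← hstar]; exact Set.star_mem_star.mpr ha
        simpa [map_star] using congrArg star (h _ ha' b hb).eq
      have h2 := this ha
      rw [StarSubalgebra.mem_comap, StarSubalgebra.mem_centralizer_iff] at h2
      exact ((h2 _ rfl).1).symm
    have := Continuous.ext_on hs ((φ.continuous_of_cstarAlgebra).mul continuous_const)
      (continuous_const.mul (φ.continuous_of_cstarAlgebra)) hb'
    exact fun a => congrFun this a
  have hb' : ∀ b ∈ StarAlgebra.adjoin ℂ t, φ a * ψ b = ψ b * φ a := fun b hb => by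
    have : StarAlgebra.adjoin ℂ t ≤ (StarSubalgebra.centralizer ℂ {φ a}).comap ψ := by
      refine StarAlgebra.adjoin_le fun b hb => ?_
      rw [SetLike.mem_coe, StarSubalgebra.mem_comap, StarSubalgebra.mem_centralizer_iff]
      rintro _ rfl
      refine ⟨(h1 b hb a).eq, ?_⟩
      simpa [map_star] using (h1 b hb (star a)).eq
    have h2 := this hb
    rw [StarSubalgebra.mem_comap, StarSubalgebra.mem_centralizer_iff] at h2
    exact (h2 _ rfl).1
  exact congrFun (Continuous.ext_on ht (continuous_const.mul (ψ.continuous_of_cstarAlgebra))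
    ((ψ.continuous_of_cstarAlgebra).mul continuous_const) hb') b

/-! ### The universal property of the free ⋆-algebra and of the algebra of a graph -/

namespace FreeStarAlgebra

variable {X : Type*} {A : Type*} [Ring A] [StarRing A]

/-- The value of a letter under an assignment of the generators. -/
def letter (v : X → A) (l : X × Bool) : A := if l.2 then star (v l.1) else v l.1

theorem star_letter (v : X → A) (l : X × Bool) : star (letter v l) = letter v (l.1, !l.2) := by
  obtain ⟨x, _ | _⟩ := l <;> simp [letter]

theorem lift_wordStar (v : X → A) (w : FreeMonoid (X × Bool)) :
    FreeMonoid.lift (letter v) (wordStar w) = star (FreeMonoid.lift (letter v) w) := by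
  induction w using FreeMonoid.recOn with
  | one => simp [wordStar]
  | of_mul l w hl =>
    rw [wordStar_mul, map_mul, map_mul, star_mul, hl]
    congr 1
    have : wordStar (FreeMonoid.of l) = FreeMonoid.of (l.1, !l.2) := rfl
    rw [this, FreeMonoid.lift_eval_of, FreeMonoid.lift_eval_of, star_letter]

variable [Algebra ℂ A] [StarModule ℂ A]

/-- The ⋆-homomorphism from the free ⋆-algebra extending an assignment of the generators. -/
noncomputable def lift (v : X → A) : FreeStarAlgebra X →⋆ₐ[ℂ] A :=
  let f : FreeStarAlgebra X →ₐ[ℂ] A :=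
    MonoidAlgebra.lift ℂ A (FreeMonoid (X × Bool)) (FreeMonoid.lift (letter v))
  have hf (w r) : f (term w r) = r • FreeMonoid.lift (letter v) w := MonoidAlgebra.lift_single ..
  { f with
    map_star' := fun a => by
      change f (star a) = star (f a)
      induction a using induction_term with
      | h0 => simp
      | hadd a b ha hb => rw [star_add, map_add, map_add, star_add, ha, hb]
      | hterm w r => rw [star_term, hf, hf, lift_wordStar, star_smul, starRingEnd_apply] }

theorem lift_of (v : X → A) (x : X) : lift v (of x) = v x := by
  have : lift v (of x) = (1 : ℂ) • FreeMonoid.lift (letter v) (FreeMonoid.of (x, false)) :=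
    MonoidAlgebra.lift_single ..
  rw [this, one_smul, FreeMonoid.lift_eval_of]
  simp [letter]

theorem adjoin_range_of : StarAlgebra.adjoin ℂ (Set.range (of : X → FreeStarAlgebra X)) = ⊤ := by
  refine StarSubalgebra.eq_top_iff.mpr fun a => ?_
  induction a using induction_term with
  | h0 => exact zero_mem _
  | hadd a b ha hb => exact add_mem ha hb
  | hterm w r =>
    have e : term w r = r • term w 1 := by rw [smul_term, mul_one]
    rw [e]
    refine StarSubalgebra.smul_mem _ ?_ r
    clear e
    induction w using FreeMonoid.recOn with
    | one => exact one_mem _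
    | of_mul l w hl =>
      have e : term (FreeMonoid.of l * w) 1 = term (FreeMonoid.of l) 1 * term w 1 := by
        rw [term_mul_term, one_mul]
      rw [e]
      refine mul_mem ?_ hl
      have hx (x : X) : of x ∈ StarAlgebra.adjoin ℂ (Set.range (of : X → FreeStarAlgebra X)) :=
        StarAlgebra.subset_adjoin ℂ _ ⟨x, rfl⟩
      obtain ⟨x, _ | _⟩ := l
      · exact hx x
      · have e' : term (FreeMonoid.of (x, true)) 1 = star (of x) := by
          rw [of, star_term, map_one]
          rfl
        rw [e']
        exact star_mem (hx x)

end FreeStarAlgebra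

namespace SimpleGraph

/-- The canonical generators of the algebra of a graph. -/
noncomputable def ccrGenerator {V : Type*} (G : SimpleGraph V) (x : V) : G.CCRAlgebra :=
  (CStarSeminorm.sup G.ccrSeminorms G.bddAbove_ccrSeminorms).toCompletion (FreeStarAlgebra.of x)

/-- A family v in A induces a homomorphism of the free algebra whose seminorm a ↦ ‖`lift v a`‖ is
admissible. It is dominated by the supremum, so the homomorphism extends to the completion. -/
theorem isUniversalCCR_ccrGenerator.{w, v} {V : Type v} (G : SimpleGraph V) :
    IsUniversalCCR.{w, v, v} G G.ccrGenerator where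
  isCCRFamily := by
    refine .of_forall (fun p : G.ccrSeminorms => p.1.toCompletion) _ (fun a b hab => ?_)
      fun p => p.2
    rw [CStarSeminorm.toCompletion_eq_iff]
    exact CStarSeminorm.sup_eq_zero _ fun p hp => p.toCompletion_eq_iff.mp (hab ⟨p, hp⟩)
  dense := by
    have := CStarSeminorm.dense_adjoin_toCompletion
      (CStarSeminorm.sup G.ccrSeminorms G.bddAbove_ccrSeminorms)
      (FreeStarAlgebra.adjoin_range_of (X := V))
    rwa [← Set.range_comp] at this
  exists_lift A _ v hv := by
    -- The completion in this seminorm identifies any two elements that `lift v` identifies, so it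
    -- inherits the relations satisfied by v.
    have hp : CStarSeminorm.ofHom (FreeStarAlgebra.lift v) ∈ G.ccrSeminorms := by
      refine .of_forall (fun _ : Unit => FreeStarAlgebra.lift v) _ (fun a b hab => ?_)
        fun _ => by simpa only [FreeStarAlgebra.lift_of] using hv
      rw [CStarSeminorm.toCompletion_eq_iff, CStarSeminorm.ofHom_apply, map_sub, hab (), sub_self,
        norm_zero]
    refine ⟨CStarSeminorm.lift _ (FreeStarAlgebra.lift v)
      (CStarSeminorm.le_sup G.bddAbove_ccrSeminorms hp), fun x => ?_⟩
    exact (CStarSeminorm.lift_toCompletion _ _ _ _).trans (FreeStarAlgebra.lift_of v x)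

end SimpleGraph

theorem StarAlgHom.mem_of_dense {A B : Type*} [CStarAlgebra A] [CStarAlgebra B] {s : Set A}
    (hs : Dense (StarAlgebra.adjoin ℂ s : Set A)) (φ : A →⋆ₐ[ℂ] B) {K : StarSubalgebra ℂ B}
    (hK : IsClosed (K : Set B)) (h : ∀ a ∈ s, φ a ∈ K) (a : A) : φ a ∈ K := by
  have hle : StarAlgebra.adjoin ℂ s ≤ K.comap φ := StarAlgebra.adjoin_le h
  have hc : IsClosed (K.comap φ : Set A) := hK.preimage φ.continuous_of_cstarAlgebra
  exact hc.closure_subset_iff.mpr hle (hs a)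

/-! ### Elementary properties of families satisfying the relations -/

namespace SimpleGraph

theorem IsCCRFamily.star_eq {V : Type*} {G : SimpleGraph V} {A : Type*} [Ring A] [StarRing A]
    {u : V → A} (h : G.IsCCRFamily u) (x : V) : star (u x) = u x := by
  have h1 := (Unitary.mem_iff.mp (h.unitary x)).1
  have h2 := h.sq_eq_one x
  rw [sq] at h2
  calc star (u x) = star (u x) * (u x * u x) := by rw [h2, mul_one]
    _ = u x := by rw [← mul_assoc, h1, one_mul]

theorem IsCCRFamily.star_range {V : Type*} {G : SimpleGraph V} {A : Type*} [Ring A] [StarRing A]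
    {u : V → A} (h : G.IsCCRFamily u) : star (Set.range u) = Set.range u := by
  ext a
  constructor
  · rintro ⟨x, hx⟩
    exact ⟨x, by rw [← star_star a, ← hx, h.star_eq]⟩
  · rintro ⟨x, rfl⟩
    exact ⟨x, (h.star_eq x).symm⟩

theorem IsCCRFamily.comp {V W : Type*} {G : SimpleGraph V} {H : SimpleGraph W} {A : Type*} [Ring A]
    [StarRing A] {u : V → A} (h : G.IsCCRFamily u) (e : H ↪g G) :
    H.IsCCRFamily (u ∘ e) where
  unitary x := h.unitary _
  sq_eq_one x := h.sq_eq_one _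
  commute x y hxy := h.commute _ _ (by rwa [e.map_adj_iff])
  anticommute x y hxy := h.anticommute _ _ (by rwa [e.map_adj_iff])

namespace IsUniversalCCR

theorem of_starAlgEquiv.{w, v, u, u'} {V : Type v} {G : SimpleGraph V} {B : Type u} {C : Type u'}
    [CStarAlgebra B] [CStarAlgebra C] {u : V → B} (h : IsUniversalCCR.{w} G u)
    (e : B ≃⋆ₐ[ℂ] C) : IsUniversalCCR.{w} G (e ∘ u) where
  isCCRFamily := h.isCCRFamily.map (e : B →⋆ₐ[ℂ] C)
  dense := by
    have h1 := (StarAlgHom.continuous_of_cstarAlgebra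
      (e : B →⋆ₐ[ℂ] C)).range_subset_closure_image_dense h.dense
    have h2 : StarAlgebra.adjoin ℂ (Set.range (e ∘ u)) =
        (StarAlgebra.adjoin ℂ (Set.range u)).map (e : B →⋆ₐ[ℂ] C) := by
      rw [StarAlgHom.map_adjoin, Set.range_comp]
      rfl
    rw [h2, StarSubalgebra.coe_map]
    exact fun c => h1 ⟨e.symm c, e.apply_symm_apply c⟩
  exists_lift A _ v hv := by
    obtain ⟨φ, hφ⟩ := h.exists_lift A v hv
    exact ⟨φ.comp (e.symm : C →⋆ₐ[ℂ] B), fun x => by simp [hφ]⟩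

end IsUniversalCCR

end SimpleGraph

/-! ### The universal property of the tensor product -/

namespace CStarTensor

variable (A B : Type*) [CStarAlgebra A] [CStarAlgebra B]

/-- The canonical map from the algebraic tensor product. -/
noncomputable def ofTensor : A ⊗[ℂ] B →⋆ₐ[ℂ] CStarTensor A B :=
  (CStarSeminorm.sup Set.univ (bddAbove_tensor A B)).toCompletion

theorem denseRange_ofTensor : DenseRange (ofTensor A B) :=
  CStarSeminorm.denseRange_toCompletion _

/-- The embedding `a ↦ a ⊗ 1`. -/
noncomputable def inl : A →⋆ₐ[ℂ] CStarTensor A B :=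
  (ofTensor A B).comp
    { (Algebra.TensorProduct.includeLeft : A →ₐ[ℂ] A ⊗[ℂ] B) with
      map_star' := fun a => by simp }

/-- The embedding `b ↦ 1 ⊗ b`. -/
noncomputable def inr : B →⋆ₐ[ℂ] CStarTensor A B :=
  (ofTensor A B).comp
    { (Algebra.TensorProduct.includeRight : B →ₐ[ℂ] A ⊗[ℂ] B) with
      map_star' := fun a => by simp }

variable {A B}

theorem inl_apply (a : A) : inl A B a = ofTensor A B (a ⊗ₜ 1) := rfl

theorem inr_apply (b : B) : inr A B b = ofTensor A B (1 ⊗ₜ b) := rfl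

theorem ofTensor_tmul (a : A) (b : B) : ofTensor A B (a ⊗ₜ b) = inl A B a * inr A B b := by
  rw [inl_apply, inr_apply, ← map_mul, Algebra.TensorProduct.tmul_mul_tmul, mul_one, one_mul]

theorem inl_mul_inr (a : A) (b : B) : inl A B a * inr A B b = inr A B b * inl A B a := by
  rw [inl_apply, inr_apply, ← map_mul, ← map_mul, Algebra.TensorProduct.tmul_mul_tmul,
    Algebra.TensorProduct.tmul_mul_tmul, mul_one, one_mul, one_mul, mul_one]

/-- A commuting pair defines a homomorphism on the algebraic tensor product, and the norm it induces
there lies below the largest C⋆-seminorm. -/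
theorem exists_lift {C : Type*} [CStarAlgebra C] (φ : A →⋆ₐ[ℂ] C) (ψ : B →⋆ₐ[ℂ] C)
    (h : ∀ a b, Commute (φ a) (ψ b)) :
    ∃ Φ : CStarTensor A B →⋆ₐ[ℂ] C, (∀ a, Φ (inl A B a) = φ a) ∧ ∀ b, Φ (inr A B b) = ψ b := by
  let f : A ⊗[ℂ] B →⋆ₐ[ℂ] C :=
    { Algebra.TensorProduct.lift φ.toAlgHom ψ.toAlgHom h with
      map_star' := fun t => by
        change Algebra.TensorProduct.lift φ.toAlgHom ψ.toAlgHom h (star t) =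
          star (Algebra.TensorProduct.lift φ.toAlgHom ψ.toAlgHom h t)
        induction t using TensorProduct.induction_on with
        | zero => simp
        | add s t hs ht => rw [star_add, map_add, map_add, star_add, hs, ht]
        | tmul a b =>
          rw [TensorProduct.star_tmul, Algebra.TensorProduct.lift_tmul,
            Algebra.TensorProduct.lift_tmul]
          change φ (star a) * ψ (star b) = star (φ a * ψ b)
          -- The adjoint reverses the product; commutation of the two ranges restores the order.
          rw [star_mul, map_star, map_star, ← map_star φ, ← map_star ψ]
          exact h _ _ }
  have hf (a : A) (b : B) : f (a ⊗ₜ b) = φ a * ψ b :=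
    Algebra.TensorProduct.lift_tmul φ.toAlgHom ψ.toAlgHom h a b
  have hle := CStarSeminorm.le_sup (bddAbove_tensor A B) (Set.mem_univ (CStarSeminorm.ofHom f))
  refine ⟨CStarSeminorm.lift _ f hle, fun a => ?_, fun b => ?_⟩
  · refine (CStarSeminorm.lift_toCompletion _ f hle _).trans ?_
    exact (hf a 1).trans (by rw [map_one, mul_one])
  · refine (CStarSeminorm.lift_toCompletion _ f hle _).trans ?_
    exact (hf 1 b).trans (by rw [map_one, one_mul])

end CStarTensor

namespace SimpleGraph

/-- No edge joins the two summands, so the mixed relations say exactly that the two families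
commute, which is the hypothesis of the universal property of the maximal tensor product. -/
theorem IsUniversalCCR.tensor.{w, v, v', u, u'} {V : Type v} {W : Type v'} {G : SimpleGraph V}
    {H : SimpleGraph W} {A : Type u} {B : Type u'} [CStarAlgebra A] [CStarAlgebra B] {u : V → A}
    {v : W → B} (hu : IsUniversalCCR.{w} G u) (hv : IsUniversalCCR.{w} H v) :
    IsUniversalCCR.{w} (G ⊕g H)
      (Sum.elim (fun x => CStarTensor.inl A B (u x)) fun y => CStarTensor.inr A B (v y)) where
  isCCRFamily := by
    have h1 := hu.isCCRFamily.map (CStarTensor.inl A B)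
    have h2 := hv.isCCRFamily.map (CStarTensor.inr A B)
    refine ⟨?_, ?_, ?_, ?_⟩
    · rintro (x | y)
      exacts [h1.unitary x, h2.unitary y]
    · rintro (x | y)
      exacts [h1.sq_eq_one x, h2.sq_eq_one y]
    · rintro (x | y) (x' | y') h
      · exact h1.commute x x' h
      · exact CStarTensor.inl_mul_inr _ _
      · exact (CStarTensor.inl_mul_inr _ _).symm
      · exact h2.commute y y' h
    · rintro (x | y) (x' | y') h
      · exact h1.anticommute x x' h
      · simp at h
      · simp at h
      · exact h2.anticommute y y' h
  dense := by
    set r := Set.range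
      (Sum.elim (fun x => CStarTensor.inl A B (u x)) fun y => CStarTensor.inr A B (v y)) with hr
    have hK := StarSubalgebra.isClosed_topologicalClosure (StarAlgebra.adjoin ℂ r)
    have hle := StarSubalgebra.le_topologicalClosure (StarAlgebra.adjoin ℂ r)
    have h1 := StarAlgHom.mem_of_dense hu.dense (CStarTensor.inl A B) hK (by
      rintro _ ⟨x, rfl⟩
      exact hle (StarAlgebra.subset_adjoin ℂ _ ⟨Sum.inl x, rfl⟩))
    have h2 := StarAlgHom.mem_of_dense hv.dense (CStarTensor.inr A B) hK (by
      rintro _ ⟨y, rfl⟩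
      exact hle (StarAlgebra.subset_adjoin ℂ _ ⟨Sum.inr y, rfl⟩))
    have h3 : Set.range (CStarTensor.ofTensor A B) ⊆
        (StarAlgebra.adjoin ℂ r).topologicalClosure := by
      rintro _ ⟨t, rfl⟩
      induction t using TensorProduct.induction_on with
      | zero => rw [map_zero]; exact zero_mem _
      | add s t hs ht => rw [map_add]; exact add_mem hs ht
      | tmul a b => rw [CStarTensor.ofTensor_tmul]; exact mul_mem (h1 a) (h2 b)
    exact fun c => hK.closure_subset_iff.mpr h3 (CStarTensor.denseRange_ofTensor A B c)
  exists_lift C _ w hw := by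
    obtain ⟨φ, hφ⟩ := hu.exists_lift C _ (hw.comp Embedding.sumInl)
    obtain ⟨ψ, hψ⟩ := hv.exists_lift C _ (hw.comp Embedding.sumInr)
    have hc := commute_of_dense hu.dense hv.dense hu.isCCRFamily.star_range φ ψ (by
      rintro _ ⟨x, rfl⟩ _ ⟨y, rfl⟩
      rw [hφ, hψ]
      exact hw.commute _ _ (by simp))
    obtain ⟨Φ, h1, h2⟩ := CStarTensor.exists_lift φ ψ hc
    refine ⟨Φ, ?_⟩
    rintro (x | y)
    · exact (h1 _).trans (hφ x)
    · exact (h2 _).trans (hψ y)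

end SimpleGraph

/-! ### Functions on Cantor cubes -/

namespace CantorCube

/-- The `j`-th coordinate of the cube `{-1, 1}^K`. -/
def coord {K : Type*} (j : K) : C(K → Bool, ℂ) where
  toFun x := if x j then 1 else -1
  continuous_toFun :=
    (continuous_of_discreteTopology (f := fun b : Bool => if b then (1 : ℂ) else -1)).comp
      (continuous_apply j)

theorem coord_apply {K : Type*} (j : K) (x : K → Bool) : coord j x = if x j then 1 else -1 := rfl

theorem isCCRFamily_coord (K : Type*) : (⊥ : SimpleGraph K).IsCCRFamily (coord (K := K)) where
  unitary j := by
    have h : star (coord j) * coord j = 1 := by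
      ext x
      simp only [ContinuousMap.mul_apply, ContinuousMap.star_apply, coord_apply]
      split_ifs <;> simp
    exact Unitary.mem_iff.mpr ⟨h, by rw [mul_comm, h]⟩
  sq_eq_one j := by
    ext x
    simp only [ContinuousMap.pow_apply, coord_apply]
    split_ifs <;> simp
  commute _ _ _ := mul_comm _ _
  anticommute _ _ h := h.elim

/-- Stone–Weierstrass: two distinct points of the cube differ in some coordinate. -/
theorem dense_adjoin_coord (K : Type*) :
    Dense (StarAlgebra.adjoin ℂ (Set.range (coord (K := K))) : Set C(K → Bool, ℂ)) := by
  have := ContinuousMap.starSubalgebra_topologicalClosure_eq_top_of_separatesPoints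
    (StarAlgebra.adjoin ℂ (Set.range (coord (K := K)))) (by
      intro x y hxy
      obtain ⟨j, hj⟩ := Function.ne_iff.mp hxy
      refine ⟨coord j, ⟨coord j, StarAlgebra.subset_adjoin ℂ _ ⟨j, rfl⟩, rfl⟩, ?_⟩
      simp only [coord_apply]
      cases hx : x j <;> cases hy : y j <;> simp [hx, hy] at hj ⊢
      all_goals norm_num)
  rw [dense_iff_closure_eq, ← StarSubalgebra.topologicalClosure_coe, this,
    StarSubalgebra.coe_top]

-- A character takes each z j to 1 or -1, so evaluation on z is a continuous map from the spectrum
-- of D to the cube. Pulling functions back along it and applying the inverse Gelfand transform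
-- gives Φ.
open WeakDual in
theorem exists_lift_of_comm {K : Type*} {D : Type*} [CommCStarAlgebra D] (z : K → D)
    (hz : ∀ j, z j ^ 2 = 1) :
    ∃ Φ : C(K → Bool, ℂ) →⋆ₐ[ℂ] D, ∀ j, Φ (coord j) = z j := by
  have hχ (χ : characterSpace ℂ D) (j : K) : χ (z j) = 1 ∨ χ (z j) = -1 := by
    refine sq_eq_sq_iff_eq_or_eq_neg.mp ?_
    rw [← map_pow, hz, map_one, one_pow]
  let g : C(characterSpace ℂ D, K → Bool) :=
    { toFun := fun χ j => decide (χ (z j) = 1)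
      continuous_toFun := by
        refine continuous_pi fun j => (continuous_bool_rng true).mpr ?_
        have hc : Continuous fun χ : characterSpace ℂ D => χ (z j) :=
          (gelfandTransform ℂ D (z j)).continuous
        have h1 : (fun χ : characterSpace ℂ D => decide (χ (z j) = 1)) ⁻¹' {true} =
            (fun χ : characterSpace ℂ D => χ (z j)) ⁻¹' {1} := by
          ext χ
          simp
        -- As only the values 1 and -1 occur, the closed set where the value is 1 is the complement
        -- of a closed set, hence clopen.
        have h2 : (fun χ : characterSpace ℂ D => χ (z j)) ⁻¹' {1} =
            ((fun χ : characterSpace ℂ D => χ (z j)) ⁻¹' {-1})ᶜ := by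
          ext χ
          simp only [Set.mem_preimage, Set.mem_singleton_iff, Set.mem_compl_iff]
          rcases hχ χ j with h | h <;> rw [h] <;> norm_num
        rw [h1]
        refine ⟨isClosed_singleton.preimage hc, ?_⟩
        rw [h2]
        exact (isClosed_singleton.preimage hc).isOpen_compl }
  refine ⟨((gelfandStarTransform D).symm : C(characterSpace ℂ D, ℂ) →⋆ₐ[ℂ] D).comp
    (ContinuousMap.compStarAlgHom' ℂ ℂ g), fun j => ?_⟩
  change (gelfandStarTransform D).symm _ = _
  rw [StarAlgEquiv.symm_apply_eq]
  ext χ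
  change (if decide (χ (z j) = 1) then (1 : ℂ) else -1) = χ (z j)
  rcases hχ χ j with h | h
  · simp [h]
  · rw [h]
    norm_num

theorem isUniversalCCR_coord.{w, v} (K : Type v) :
    SimpleGraph.IsUniversalCCR.{w} (⊥ : SimpleGraph K) (coord (K := K)) where
  isCCRFamily := isCCRFamily_coord K
  dense := dense_adjoin_coord K
  exists_lift A _ z hz := by
    -- The family consists of commuting self-adjoint elements, so the closed ⋆-algebra it generates
    -- is commutative and Gelfand duality applies inside it.
    let S : StarSubalgebra ℂ A := (StarAlgebra.adjoin ℂ (Set.range z)).topologicalClosure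
    have hcomm : ∀ a b : StarAlgebra.adjoin ℂ (Set.range z), a * b = b * a := by
      have : IsMulCommutative (StarAlgebra.adjoin ℂ (Set.range z)) := by
        refine StarAlgebra.isMulCommutative_adjoin ℂ ?_ ?_
        · rintro _ ⟨i, rfl⟩ _ ⟨j, rfl⟩
          exact hz.commute i j id
        · rintro _ ⟨i, rfl⟩ _ ⟨j, rfl⟩
          rw [hz.star_eq]
          exact hz.commute i j id
      exact mul_comm'
    have : IsClosed (S : Set A) := StarSubalgebra.isClosed_topologicalClosure _
    let : CommCStarAlgebra S :=
      { (inferInstance : CStarAlgebra S) with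
        mul_comm :=
          (StarSubalgebra.commRingTopologicalClosure _ hcomm).mul_comm }
    obtain ⟨Φ, hΦ⟩ := exists_lift_of_comm (D := S)
      (fun j => ⟨z j, StarSubalgebra.le_topologicalClosure _
        (StarAlgebra.subset_adjoin ℂ _ ⟨j, rfl⟩)⟩) fun j => Subtype.ext (hz.sq_eq_one j)
    exact ⟨S.subtype.comp Φ, fun j => congrArg Subtype.val (hΦ j)⟩

end CantorCube

/-- The natural numbers below `n`. -/
abbrev ENat.Below (n : ℕ∞) : Type := {i : ℕ // (i : ℕ∞) < n}

theorem ENat.below_coe_equiv_fin (k : ℕ) : Nonempty (ENat.Below k ≃ Fin k) :=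
  ⟨(Equiv.subtypeEquivRight fun i => by simp).trans Fin.equivSubtype.symm⟩

/-- For finite n the cube is a discrete space of 2^n points, and for n = ∞ it is the Cantor space
after reindexing the coordinates. -/
theorem exists_starAlgEquiv_commFactor (n : ℕ∞) :
    Nonempty (C(ENat.Below n → Bool, ℂ) ≃⋆ₐ[ℂ] CommFactor n) := by
  induction n using ENat.recTopCoe with
  | top =>
    let e : ℕ ≃ ENat.Below ⊤ :=
      ((Equiv.subtypeEquivRight fun i => by simp).trans (Equiv.Set.univ ℕ)).symm
    let h : (ℕ → Bool) ≃ₜ (ENat.Below ⊤ → Bool) := Homeomorph.piCongrLeft (Y := fun _ => Bool) e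
    exact ⟨h.compStarAlgEquiv' ℂ ℂ⟩
  | coe k =>
    obtain ⟨e⟩ := ENat.below_coe_equiv_fin k
    have : Fintype (ENat.Below k) := Fintype.ofEquiv _ e.symm
    have hcard : Fintype.card (ENat.Below k → Bool) = 2 ^ k := by
      classical
      rw [Fintype.card_fun, Fintype.card_bool, Fintype.card_congr e, Fintype.card_fin]
    let ε : (ENat.Below k → Bool) ≃ Fin (2 ^ k) := Fintype.equivFinOfCardEq hcard
    exact ⟨(
      { toFun := fun f i => f (ε.symm i)
        invFun := fun f => ⟨fun x => f (ε x), continuous_of_discreteTopology⟩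
        left_inv := fun f => by ext x; simp
        right_inv := fun f => by ext x; simp
        map_mul' := fun _ _ => rfl
        map_add' := fun _ _ => rfl
        map_star' := fun _ => rfl
        map_smul' := fun _ _ => rfl } : C(ENat.Below k → Bool, ℂ) ≃⋆ₐ[ℂ] (Fin (2 ^ k) → ℂ))⟩

theorem exists_isUniversalCCR_commFactor.{w} (n : ℕ∞) :
    ∃ u : ENat.Below n → CommFactor n,
      SimpleGraph.IsUniversalCCR.{w} (⊥ : SimpleGraph (ENat.Below n)) u := by
  obtain ⟨e⟩ := exists_starAlgEquiv_commFactor n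
  exact ⟨_, (CantorCube.isUniversalCCR_coord _).of_starAlgEquiv e⟩

/-! ### Pauli matrices -/

/-- The disjoint union of edges indexed by `K`. -/
def SimpleGraph.pairGraph (K : Type*) : SimpleGraph (K × Bool) where
  Adj p q := p.1 = q.1 ∧ p.2 ≠ q.2
  symm := ⟨fun _ _ h => ⟨h.1.symm, h.2.symm⟩⟩
  loopless := ⟨fun _ h => h.2 rfl⟩

namespace LocalMatrix

/-- Splitting off the highest binary digit of an index. -/
def splitTop (k : ℕ) : Bool × Fin (2 ^ k) ≃ Fin (2 ^ (k + 1)) where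
  toFun p := ⟨2 ^ k * p.1.toNat + p.2, by
    have h1 := p.1.toNat_le
    have h2 := p.2.2
    rw [pow_succ]
    nlinarith⟩
  invFun x := (decide (2 ^ k ≤ (x : ℕ)), lowIndex k x)
  left_inv p := by
    obtain ⟨s, x⟩ := p
    have hx := x.2
    cases s <;> simp [lowIndex, Nat.mod_eq_of_lt hx]
  right_inv x := by
    have hx : (x : ℕ) < 2 ^ k * 2 := lt_of_lt_of_eq x.2 (pow_succ 2 k)
    ext
    by_cases h : 2 ^ k ≤ (x : ℕ)
    · have h1 : (x : ℕ) % 2 ^ k = x - 2 ^ k := by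
        rw [Nat.mod_eq_sub_mod h, Nat.mod_eq_of_lt (by omega)]
      simp only [h, lowIndex, decide_true, Bool.toNat_true, h1]
      omega
    · simp [h, lowIndex, Nat.mod_eq_of_lt (not_le.mp h)]

theorem splitTop_div (k : ℕ) (p : Bool × Fin (2 ^ k)) :
    (splitTop k p : ℕ) / 2 ^ k = p.1.toNat := by
  change (2 ^ k * p.1.toNat + p.2) / 2 ^ k = _
  rw [Nat.mul_add_div (by positivity), Nat.div_eq_of_lt p.2.2, add_zero]

theorem lowIndex_splitTop (k : ℕ) (p : Bool × Fin (2 ^ k)) : lowIndex k (splitTop k p) = p.2 :=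
  congrArg Prod.snd ((splitTop k).symm_apply_apply p)

theorem ext_splitTop {k : ℕ} {a b : Matrix (Fin (2 ^ (k + 1))) (Fin (2 ^ (k + 1))) ℂ}
    (h : ∀ s t x y, a (splitTop k (s, x)) (splitTop k (t, y)) =
      b (splitTop k (s, x)) (splitTop k (t, y))) : a = b := by
  ext x y
  obtain ⟨⟨s, x⟩, rfl⟩ := (splitTop k).surjective x
  obtain ⟨⟨t, y⟩, rfl⟩ := (splitTop k).surjective y
  exact h s t x y

theorem mul_splitTop {k : ℕ} (a b : Matrix (Fin (2 ^ (k + 1))) (Fin (2 ^ (k + 1))) ℂ) (x y) :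
    (a * b) x y = ∑ t, ∑ z, a x (splitTop k (t, z)) * b (splitTop k (t, z)) y := by
  rw [Matrix.mul_apply, ← (splitTop k).sum_comp, Fintype.sum_prod_type]

theorem diagEmb_succ_apply (k : ℕ) (a : Matrix (Fin (2 ^ k)) (Fin (2 ^ k)) ℂ) (s t : Bool) (x y) :
    diagEmb k (k + 1) k.le_succ a (splitTop k (s, x)) (splitTop k (t, y)) =
      if s = t then a x y else 0 := by
  change (if (splitTop k (s, x) : ℕ) / 2 ^ k = (splitTop k (t, y) : ℕ) / 2 ^ k then
    a (lowIndex k (splitTop k (s, x))) (lowIndex k (splitTop k (t, y))) else 0) = _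
  rw [splitTop_div, splitTop_div, lowIndex_splitTop, lowIndex_splitTop]
  refine if_congr ⟨fun h => ?_, congrArg _⟩ rfl rfl
  cases s <;> cases t <;> simp at h ⊢

theorem diagEmb_diagEmb {i j k : ℕ} (hij : i ≤ j) (hjk : j ≤ k)
    (a : Matrix (Fin (2 ^ i)) (Fin (2 ^ i)) ℂ) :
    diagEmb j k hjk (diagEmb i j hij a) = diagEmb i k (hij.trans hjk) a :=
  DirectedSystem.map_map' (fun i j h => diagEmb i j h) hij hjk a

theorem diagEmb_self {i : ℕ} (a : Matrix (Fin (2 ^ i)) (Fin (2 ^ i)) ℂ) :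
    diagEmb i i le_rfl a = a :=
  DirectedSystem.map_self' (fun i j h => diagEmb i j h) a

/-- The `(s, t)` block of a matrix. -/
def block {k : ℕ} (s t : Bool) :
    Matrix (Fin (2 ^ (k + 1))) (Fin (2 ^ (k + 1))) ℂ →ₗ[ℂ]
      Matrix (Fin (2 ^ k)) (Fin (2 ^ k)) ℂ where
  toFun a := Matrix.of fun x y => a (splitTop k (s, x)) (splitTop k (t, y))
  map_add' _ _ := rfl
  map_smul' _ _ := rfl

theorem block_apply {k : ℕ} (s t : Bool) (a : Matrix (Fin (2 ^ (k + 1))) (Fin (2 ^ (k + 1))) ℂ)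
    (x y) : block s t a x y = a (splitTop k (s, x)) (splitTop k (t, y)) := rfl

theorem block_diagEmb {k : ℕ} (s t : Bool) (a : Matrix (Fin (2 ^ k)) (Fin (2 ^ k)) ℂ) :
    block s t (diagEmb k (k + 1) k.le_succ a) = if s = t then a else 0 := by
  ext x y
  rw [block_apply, diagEmb_succ_apply]
  split_ifs <;> rfl

theorem block_one {k : ℕ} (s t : Bool) :
    block (k := k) s t 1 = if s = t then 1 else 0 := by
  rw [← map_one (diagEmb k (k + 1) k.le_succ), block_diagEmb]

theorem block_mul {k : ℕ} (s r : Bool) (a b : Matrix (Fin (2 ^ (k + 1))) (Fin (2 ^ (k + 1))) ℂ) :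
    block s r (a * b) = ∑ t, block s t a * block t r b := by
  ext x y
  rw [block_apply, mul_splitTop, Matrix.sum_apply]
  refine Finset.sum_congr rfl fun t _ => ?_
  rw [Matrix.mul_apply]
  rfl

theorem block_star {k : ℕ} (s t : Bool) (a : Matrix (Fin (2 ^ (k + 1))) (Fin (2 ^ (k + 1))) ℂ) :
    block s t (star a) = star (block t s a) := rfl

/-- The matrix with an identity matrix as its `(s, t)` block and zeros elsewhere. -/
def unitBlock (k : ℕ) (s t : Bool) : Matrix (Fin (2 ^ (k + 1))) (Fin (2 ^ (k + 1))) ℂ :=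
  Matrix.of fun x y => if ((splitTop k).symm x).1 = s ∧ ((splitTop k).symm y).1 = t ∧
    ((splitTop k).symm x).2 = ((splitTop k).symm y).2 then 1 else 0

theorem unitBlock_apply (k : ℕ) (s t s' t' : Bool) (x y) :
    unitBlock k s t (splitTop k (s', x)) (splitTop k (t', y)) =
      if s' = s ∧ t' = t ∧ x = y then 1 else 0 := by
  simp [unitBlock]

theorem block_unitBlock (k : ℕ) (s t s' t' : Bool) :
    block s' t' (unitBlock k s t) = if s' = s ∧ t' = t then 1 else 0 := by
  ext x y
  rw [block_apply, unitBlock_apply]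
  by_cases h : s' = s ∧ t' = t
  · simp [h, Matrix.one_apply]
  · rw [if_neg h, if_neg fun h' => h ⟨h'.1, h'.2.1⟩]
    rfl

theorem ext_block {k : ℕ} {a b : Matrix (Fin (2 ^ (k + 1))) (Fin (2 ^ (k + 1))) ℂ}
    (h : ∀ s t, block s t a = block s t b) : a = b :=
  ext_splitTop fun s t x y => congrFun (congrFun (h s t) x) y

theorem unitBlock_mul (k : ℕ) (s t t' r : Bool) :
    unitBlock k s t * unitBlock k t' r = if t = t' then unitBlock k s r else 0 := by
  refine ext_block fun s' r' => ?_
  rw [block_mul, Fintype.sum_bool]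
  simp only [block_unitBlock, apply_ite (block s' r'), map_zero]
  cases s <;> cases t <;> cases t' <;> cases r <;> cases s' <;> cases r' <;> simp

theorem star_unitBlock (k : ℕ) (s t : Bool) : star (unitBlock k s t) = unitBlock k t s := by
  refine ext_block fun s' r' => ?_
  rw [block_star, block_unitBlock, block_unitBlock, apply_ite star, star_one, star_zero]
  exact if_congr and_comm rfl rfl

theorem unitBlock_add (k : ℕ) : unitBlock k false false + unitBlock k true true = 1 := by
  refine ext_block fun s' r' => ?_
  rw [map_add, block_unitBlock, block_unitBlock, block_one]
  cases s' <;> cases r' <;> simp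

/-- The range of the embedding and the block units are the two tensor factors of M_{2^k} ⊗ M_2: the
embedding acts on the low digits, the units on the top digit. -/
theorem diagEmb_mul_unitBlock (k : ℕ) (s t : Bool) (a : Matrix (Fin (2 ^ k)) (Fin (2 ^ k)) ℂ) :
    diagEmb k (k + 1) k.le_succ a * unitBlock k s t =
      unitBlock k s t * diagEmb k (k + 1) k.le_succ a := by
  refine ext_block fun s' r' => ?_
  rw [block_mul, block_mul, Fintype.sum_bool, Fintype.sum_bool]
  simp only [block_unitBlock, block_diagEmb]
  cases s <;> cases t <;> cases s' <;> cases r' <;> simp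

theorem eq_sum_unitBlock {k : ℕ} (a : Matrix (Fin (2 ^ (k + 1))) (Fin (2 ^ (k + 1))) ℂ) :
    a = ∑ s, ∑ t, diagEmb k (k + 1) k.le_succ (block s t a) * unitBlock k s t := by
  refine ext_block fun s' r' => ?_
  simp only [Fintype.sum_bool, map_add, block_mul, block_unitBlock, block_diagEmb]
  cases s' <;> cases r' <;> simp

/-- The Pauli matrices `Z` (for `false`) and `X` (for `true`) acting on the `k`-th binary digit. -/
def pauli (k : ℕ) (s : Bool) : Matrix (Fin (2 ^ (k + 1))) (Fin (2 ^ (k + 1))) ℂ :=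
  if s then unitBlock k false true + unitBlock k true false
  else unitBlock k false false - unitBlock k true true

theorem star_pauli (k : ℕ) (s : Bool) : star (pauli k s) = pauli k s := by
  cases s <;> simp [pauli, star_unitBlock, add_comm]

theorem pauli_mul_self (k : ℕ) (s : Bool) : pauli k s * pauli k s = 1 := by
  cases s <;> simp [pauli, mul_add, add_mul, mul_sub, sub_mul, unitBlock_mul, unitBlock_add,
    add_comm (unitBlock k true true)]

theorem pauli_anticommute (k : ℕ) :
    pauli k false * pauli k true = -(pauli k true * pauli k false) := by
  simp [pauli, mul_add, add_mul, unitBlock_mul, sub_eq_add_neg]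

theorem diagEmb_mul_pauli (k : ℕ) (s : Bool) (a : Matrix (Fin (2 ^ k)) (Fin (2 ^ k)) ℂ) :
    diagEmb k (k + 1) k.le_succ a * pauli k s = pauli k s * diagEmb k (k + 1) k.le_succ a := by
  cases s <;> simp [pauli, mul_add, add_mul, mul_sub, sub_mul, diagEmb_mul_unitBlock]

/-- Pauli matrices at different digits commute because the lower one is block-scalar in the higher
digit; at equal digits Z and X anticommute. A compatible family ι of maps up to level m serves both
the matrix algebras (ι the block-diagonal embeddings) and the direct limit. -/
theorem isCCRFamily_pauli {m : ℕ∞} {B : Type*} [Ring B] [StarRing B] [Algebra ℂ B]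
    (ι : ∀ k : ℕ, (k : ℕ∞) ≤ m → (Matrix (Fin (2 ^ k)) (Fin (2 ^ k)) ℂ →⋆ₐ[ℂ] B))
    (hι : ∀ i j hij hi hj a, ι j hj (diagEmb i j hij a) = ι i hi a) :
    (SimpleGraph.pairGraph (ENat.Below m)).IsCCRFamily fun p =>
      ι (p.1 + 1) (by exact_mod_cast Order.add_one_le_of_lt p.1.2) (pauli p.1 p.2) := by
  have hcomm (i j : ENat.Below m) (hij : i.1 < j.1) (s t : Bool) :
      ι (i + 1) (by exact_mod_cast Order.add_one_le_of_lt i.2) (pauli i s) *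
        ι (j + 1) (by exact_mod_cast Order.add_one_le_of_lt j.2) (pauli j t) =
      ι (j + 1) (by exact_mod_cast Order.add_one_le_of_lt j.2) (pauli j t) *
        ι (i + 1) (by exact_mod_cast Order.add_one_le_of_lt i.2) (pauli i s) := by
    -- The lower matrix is carried to level j + 1 by way of level j, which places it in the range of
    -- `diagEmb j (j + 1)`, where `diagEmb_mul_pauli` applies.
    rw [← hι (i + 1) (j + 1) (by omega) _ (by exact_mod_cast Order.add_one_le_of_lt j.2),
      ← diagEmb_diagEmb (Nat.succ_le_of_lt hij) (Nat.le_succ _), ← map_mul, diagEmb_mul_pauli,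
      map_mul]
  refine ⟨?_, ?_, ?_, ?_⟩
  · rintro ⟨i, s⟩
    rw [Unitary.mem_iff, ← map_star, ← map_mul, ← map_mul, star_pauli, pauli_mul_self, map_one]
    exact ⟨rfl, rfl⟩
  · rintro ⟨i, s⟩
    rw [sq, ← map_mul, pauli_mul_self, map_one]
  · rintro ⟨i, s⟩ ⟨j, t⟩ h
    rcases lt_trichotomy i.1 j.1 with hij | hij | hij
    · exact hcomm i j hij s t
    · obtain rfl := Subtype.ext hij
      have hst : s = t := by
        by_contra hst
        exact h ⟨rfl, hst⟩
      rw [hst]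
    · exact (hcomm j i hij t s).symm
  · rintro ⟨i, s⟩ ⟨j, t⟩ ⟨hij, hst⟩
    obtain rfl : i = j := hij
    simp only
    rw [← map_mul, ← map_mul, ← map_neg]
    congr 1
    cases s <;> cases t <;> simp at hst
    · exact pauli_anticommute i
    · rw [pauli_anticommute, neg_neg]

/-- By induction the lower Pauli matrices generate the embedded M_{2^k}. The new pair generates the
four block units, starting from the spectral projection (1 + Z)/2, and these together with M_{2^k}
span the next level by `eq_sum_unitBlock`. -/
theorem adjoin_pauli (k : ℕ) : StarAlgebra.adjoin ℂ
    {a | ∃ (i : ℕ) (h : i + 1 ≤ k) (s : Bool), a = diagEmb (i + 1) k h (pauli i s)} = ⊤ := by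
  induction k with
  | zero =>
    refine StarSubalgebra.eq_top_iff.mpr fun a => ?_
    have : a = algebraMap ℂ _ (a 0 0) := by
      ext x y
      obtain rfl : x = 0 := Subsingleton.elim (α := Fin 1) _ _
      obtain rfl : y = 0 := Subsingleton.elim (α := Fin 1) _ _
      simp [Matrix.algebraMap_matrix_apply]
    rw [this]
    exact algebraMap_mem _ _
  | succ k ih =>
    refine StarSubalgebra.eq_top_iff.mpr fun a => ?_
    set S := StarAlgebra.adjoin ℂ {a | ∃ (i : ℕ) (h : i + 1 ≤ k + 1) (s : Bool),
      a = diagEmb (i + 1) (k + 1) h (pauli i s)}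
    have h1 (b) : diagEmb k (k + 1) k.le_succ b ∈ S := by
      have hle : (⊤ : StarSubalgebra ℂ _) ≤ S.comap (diagEmb k (k + 1) k.le_succ) := by
        rw [← ih]
        refine StarAlgebra.adjoin_le ?_
        rintro _ ⟨i, hi, s, rfl⟩
        exact StarAlgebra.subset_adjoin ℂ _ ⟨i, by omega, s, diagEmb_diagEmb _ k.le_succ _⟩
      exact hle StarSubalgebra.mem_top
    have hp (s : Bool) : pauli k s ∈ S :=
      StarAlgebra.subset_adjoin ℂ _ ⟨k, le_rfl, s, (diagEmb_self _).symm⟩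
    have h00 : unitBlock k false false = (1 / 2 : ℂ) • (1 + pauli k false) := by
      rw [← unitBlock_add, pauli, if_neg (by simp), add_add_sub_cancel, ← two_smul ℂ, smul_smul]
      norm_num
    have h00' : unitBlock k false false ∈ S := by
      rw [h00]
      exact StarSubalgebra.smul_mem _ (add_mem (one_mem _) (hp false)) _
    have h2 (s t : Bool) : unitBlock k s t ∈ S := by
      cases s <;> cases t
      · exact h00'
      · have : unitBlock k false true = unitBlock k false false * pauli k true := by
          simp [pauli, mul_add, unitBlock_mul]
        rw [this]
        exact mul_mem h00' (hp true)
      · have : unitBlock k true false = pauli k true * unitBlock k false false := by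
          simp [pauli, add_mul, unitBlock_mul]
        rw [this]
        exact mul_mem (hp true) h00'
      · rw [eq_sub_of_add_eq' (unitBlock_add k)]
        exact sub_mem (one_mem _) h00'
    rw [eq_sum_unitBlock a]
    exact sum_mem fun s _ => sum_mem fun t _ => mul_mem (h1 _) (h2 s t)

/-- The extension of a ⋆-homomorphism from `M_{2^k}(ℂ)` to `M_{2^(k+1)}(ℂ)` determined by a system
of `2 × 2` matrix units commuting with its range. -/
def extend {k : ℕ} {A : Type*} [Ring A] [StarRing A] [Algebra ℂ A]
    (φ : Matrix (Fin (2 ^ k)) (Fin (2 ^ k)) ℂ →⋆ₐ[ℂ] A) (w : Bool → Bool → A)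
    (hmul : ∀ s t t' r, w s t * w t' r = if t = t' then w s r else 0)
    (hstar : ∀ s t, star (w s t) = w t s) (hadd : w false false + w true true = 1)
    (hcomm : ∀ s t a, w s t * φ a = φ a * w s t) :
    Matrix (Fin (2 ^ (k + 1))) (Fin (2 ^ (k + 1))) ℂ →⋆ₐ[ℂ] A :=
  let f : Matrix (Fin (2 ^ (k + 1))) (Fin (2 ^ (k + 1))) ℂ →ₗ[ℂ] A :=
    ∑ s, ∑ t, (LinearMap.mulRight ℂ (w s t)) ∘ₗ φ.toAlgHom.toLinearMap ∘ₗ block s t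
  have hf (a) : f a = ∑ s, ∑ t, φ (block s t a) * w s t := by
    simp only [f, LinearMap.sum_apply]
    rfl
  have h1 : f 1 = 1 := by
    rw [hf]
    simp [block_one, add_comm (w true true), hadd]
  -- Moving the units past φ collapses each product of two terms; multiplicativity of f is then
  -- multiplication of block matrices.
  have hw (s t t' r a b) : (φ a * w s t) * (φ b * w t' r) =
      if t = t' then φ (a * b) * w s r else 0 := by
    rw [mul_assoc, ← mul_assoc (w s t), hcomm, mul_assoc, hmul, ← mul_assoc, ← map_mul]
    split_ifs
    · rfl
    · rw [mul_zero]
  { AlgHom.ofLinearMap f h1 (fun a b => by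
      simp only [hf, Fintype.sum_bool, mul_add, add_mul, hw, block_mul, map_add]
      simp only [if_true, Bool.true_eq_false, Bool.false_eq_true, if_false]
      abel) with
    map_star' := fun a => by
      change f (star a) = star (f a)
      rw [hf, hf, Finset.sum_comm]
      simp only [star_sum, star_mul, hstar, block_star, map_star]
      refine Finset.sum_congr rfl fun s _ => Finset.sum_congr rfl fun t _ => ?_
      rw [← map_star, hcomm] }

theorem extend_apply {k : ℕ} {A : Type*} [Ring A] [StarRing A] [Algebra ℂ A]
    (φ : Matrix (Fin (2 ^ k)) (Fin (2 ^ k)) ℂ →⋆ₐ[ℂ] A) (w : Bool → Bool → A)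
    (hmul : ∀ s t t' r, w s t * w t' r = if t = t' then w s r else 0)
    (hstar : ∀ s t, star (w s t) = w t s) (hadd : w false false + w true true = 1)
    (hcomm : ∀ s t a, w s t * φ a = φ a * w s t) (a) :
    extend φ w hmul hstar hadd hcomm a = ∑ s, ∑ t, φ (block s t a) * w s t := by
  change (∑ s, ∑ t, (LinearMap.mulRight ℂ (w s t)) ∘ₗ φ.toAlgHom.toLinearMap ∘ₗ block s t :
    Matrix (Fin (2 ^ (k + 1))) (Fin (2 ^ (k + 1))) ℂ →ₗ[ℂ] A) a = _
  simp only [LinearMap.sum_apply]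
  rfl

theorem extend_diagEmb {k : ℕ} {A : Type*} [Ring A] [StarRing A] [Algebra ℂ A]
    (φ : Matrix (Fin (2 ^ k)) (Fin (2 ^ k)) ℂ →⋆ₐ[ℂ] A) (w : Bool → Bool → A)
    (hmul : ∀ s t t' r, w s t * w t' r = if t = t' then w s r else 0)
    (hstar : ∀ s t, star (w s t) = w t s) (hadd : w false false + w true true = 1)
    (hcomm : ∀ s t a, w s t * φ a = φ a * w s t) (a) :
    extend φ w hmul hstar hadd hcomm (diagEmb k (k + 1) k.le_succ a) = φ a := by
  rw [extend_apply]
  simp only [block_diagEmb, Fintype.sum_bool]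
  simp [← mul_add, add_comm (w true true), hadd]

theorem extend_unitBlock {k : ℕ} {A : Type*} [Ring A] [StarRing A] [Algebra ℂ A]
    (φ : Matrix (Fin (2 ^ k)) (Fin (2 ^ k)) ℂ →⋆ₐ[ℂ] A) (w : Bool → Bool → A)
    (hmul : ∀ s t t' r, w s t * w t' r = if t = t' then w s r else 0)
    (hstar : ∀ s t, star (w s t) = w t s) (hadd : w false false + w true true = 1)
    (hcomm : ∀ s t a, w s t * φ a = φ a * w s t) (s t : Bool) :
    extend φ w hmul hstar hadd hcomm (unitBlock k s t) = w s t := by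
  rw [extend_apply]
  simp only [block_unitBlock, Fintype.sum_bool]
  cases s <;> cases t <;> simp

/-! ### Matrix units from an anticommuting pair of symmetries -/

section matrixUnit

variable {A : Type*} [Ring A] [Algebra ℂ A]

/-- The spectral projections of a symmetry. -/
noncomputable def symmetryProj (e : A) (s : Bool) : A := (1 / 2 : ℂ) • (1 + if s then -e else e)

/-- The `2 × 2` matrix units associated with an anticommuting pair of symmetries. -/
noncomputable def matrixUnit (e f : A) (s t : Bool) : A :=
  symmetryProj e s * if s = t then 1 else f

theorem symmetryProj_mul {e : A} (he : e * e = 1) (s t : Bool) :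
    symmetryProj e s * symmetryProj e t = if s = t then symmetryProj e s else 0 := by
  have h2 (a : A) : (1 / 2 : ℂ) • (1 / 2 : ℂ) • (a + a) = (1 / 2 : ℂ) • a := by
    rw [← two_smul ℂ a, smul_smul (1 / 2 : ℂ) 2]
    norm_num
  have h3 (g : A) (hg : g * g = 1) : (1 + g) * (1 + g) = (1 + g) + (1 + g) := by
    rw [mul_add, add_mul, add_mul, hg, mul_one, mul_one, one_mul, add_comm g 1]
  rw [symmetryProj, symmetryProj, smul_mul_smul_comm, ← smul_smul]
  cases s <;> cases t <;> simp only [if_true, Bool.true_eq_false, Bool.false_eq_true, if_false]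
  · rw [h3 e he, h2]
  · have : (1 + e) * (1 + -e) = 0 := by
      rw [mul_add, add_mul, add_mul, mul_neg, mul_neg, he, mul_one, mul_one, one_mul]
      abel
    rw [this, smul_zero, smul_zero]
  · have : (1 + -e) * (1 + e) = 0 := by
      rw [mul_add, add_mul, add_mul, neg_mul, neg_mul, he, mul_one, mul_one, one_mul]
      abel
    rw [this, smul_zero, smul_zero]
  · rw [h3 (-e) (by rw [neg_mul_neg, he]), h2]

/-- Conjugation by f sends e to -e and so exchanges the two spectral projections of e. This is why a
projection times f behaves as an off-diagonal matrix unit. -/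
theorem mul_symmetryProj {e f : A} (hef : e * f = -(f * e)) (s : Bool) :
    f * symmetryProj e s = symmetryProj e (!s) * f := by
  rw [symmetryProj, symmetryProj, mul_smul_comm, smul_mul_assoc]
  cases s <;> simp [mul_add, add_mul, hef]

theorem matrixUnit_mul {e f : A} (he : e * e = 1) (hf : f * f = 1) (hef : e * f = -(f * e))
    (s t t' r : Bool) :
    matrixUnit e f s t * matrixUnit e f t' r = if t = t' then matrixUnit e f s r else 0 := by
  have h1 (s t : Bool) : symmetryProj e s * f * symmetryProj e t =
      if s = !t then symmetryProj e s * f else 0 := by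
    rw [mul_assoc, mul_symmetryProj hef, ← mul_assoc, symmetryProj_mul he]
    split_ifs <;> simp
  simp only [matrixUnit]
  cases s <;> cases t <;> cases t' <;> cases r <;>
    simp [← mul_assoc, h1, symmetryProj_mul he, mul_assoc _ f f, hf]

theorem star_matrixUnit [StarRing A] [StarModule ℂ A] {e f : A} (hef : e * f = -(f * e))
    (hse : star e = e) (hsf : star f = f) (s t : Bool) :
    star (matrixUnit e f s t) = matrixUnit e f t s := by
  have h1 (s : Bool) : star (symmetryProj e s) = symmetryProj e s := by
    rw [symmetryProj, star_smul]
    cases s <;> simp [hse]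
  rw [matrixUnit, star_mul, h1, matrixUnit]
  cases s <;> cases t <;> simp [hsf, mul_symmetryProj hef]

theorem matrixUnit_add {e f : A} : matrixUnit e f false false + matrixUnit e f true true = 1 := by
  simp only [matrixUnit, symmetryProj, if_true, Bool.false_eq_true, if_false, mul_one, ← smul_add]
  rw [add_add_add_comm, add_neg_cancel, add_zero, ← two_smul ℂ, smul_smul]
  norm_num

/-- Together with `matrixUnit_add_swap` this recovers e and f by the formulas that define `pauli`,
so `extend` carries the Pauli pair to the given pair. -/
theorem matrixUnit_sub {e f : A} : matrixUnit e f false false - matrixUnit e f true true = e := by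
  simp only [matrixUnit, symmetryProj, if_true, Bool.false_eq_true, if_false, mul_one, ← smul_sub]
  rw [add_sub_add_left_eq_sub, sub_neg_eq_add, ← two_smul ℂ, smul_smul]
  norm_num

theorem matrixUnit_add_swap {e f : A} :
    matrixUnit e f false true + matrixUnit e f true false = f := by
  have h := matrixUnit_add (e := e) (f := f)
  simp only [matrixUnit, if_true, mul_one] at h
  simp [matrixUnit, ← add_mul, h]

theorem matrixUnit_comm {e f a : A} (he : e * a = a * e) (hf : f * a = a * f) (s t : Bool) :
    matrixUnit e f s t * a = a * matrixUnit e f s t := by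
  have h1 : symmetryProj e s * a = a * symmetryProj e s := by
    rw [symmetryProj, mul_smul_comm, smul_mul_assoc]
    cases s <;> simp [mul_add, add_mul, he]
  rw [matrixUnit]
  split_ifs
  · rw [mul_one, h1]
  · rw [mul_assoc, hf, ← mul_assoc, h1, mul_assoc]

end matrixUnit

/-! ### Universality of the matrix algebras and of the CAR algebra -/

theorem exists_lift {m : ℕ∞} {A : Type*} [Ring A] [StarRing A] [Algebra ℂ A] [StarModule ℂ A]
    {v : ENat.Below m × Bool → A} (hv : (SimpleGraph.pairGraph (ENat.Below m)).IsCCRFamily v)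
    (k : ℕ) (hk : (k : ℕ∞) ≤ m) :
    ∃ φ : Matrix (Fin (2 ^ k)) (Fin (2 ^ k)) ℂ →⋆ₐ[ℂ] A,
      ∀ (i : ℕ) (hi : i + 1 ≤ k) (s : Bool), φ (diagEmb (i + 1) k hi (pauli i s)) =
        v (⟨i, lt_of_lt_of_le (by exact_mod_cast hi) hk⟩, s) := by
  induction k with
  | zero =>
    -- At level 0 the matrices have size 2^0 = 1, so they are scalars and there is no Pauli matrix
    -- to prescribe.
    refine ⟨{ toFun := fun a => algebraMap ℂ A (a 0 0)
              map_one' := by simp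
              map_zero' := by simp
              map_mul' := fun a b => by
                rw [← map_mul, Matrix.mul_apply]
                exact congrArg _ (Fintype.sum_unique (ι := Fin 1) _)
              map_add' := fun a b => by simp
              commutes' := fun r => by simp [Matrix.algebraMap_matrix_apply]
              map_star' := fun a => algebraMap_star_comm (a 0 0) }, fun i hi => by omega⟩
  | succ k ih =>
    have hkm : (k : ℕ∞) < m := lt_of_lt_of_le (by exact_mod_cast k.lt_succ_self) hk
    obtain ⟨φ, hφ⟩ := ih hkm.le
    set K : ENat.Below m := ⟨k, hkm⟩ with hK
    have hsq (s : Bool) : v (K, s) * v (K, s) = 1 := by rw [← sq, hv.sq_eq_one]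
    have hanti : v (K, false) * v (K, true) = -(v (K, true) * v (K, false)) :=
      hv.anticommute _ _ ⟨rfl, by simp⟩
    -- The pair at digit k is not adjacent to any earlier pair, and the earlier Pauli matrices
    -- generate M_{2^k}, so it commutes with the whole range of φ. Its matrix units can therefore
    -- extend φ by one digit.
    have hcomm (s : Bool) (a) : v (K, s) * φ a = φ a * v (K, s) := by
      have hle : (⊤ : StarSubalgebra ℂ _) ≤ (StarSubalgebra.centralizer ℂ {v (K, s)}).comap φ := by
        rw [← adjoin_pauli k]
        refine StarAlgebra.adjoin_le ?_
        rintro _ ⟨i, hi, t, rfl⟩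
        rw [SetLike.mem_coe, StarSubalgebra.mem_comap, StarSubalgebra.mem_centralizer_iff]
        rintro _ rfl
        rw [hφ, hv.star_eq]
        have hne (him) : ¬ (SimpleGraph.pairGraph (ENat.Below m)).Adj (K, s) (⟨i, him⟩, t) :=
          fun h => by
            have : k = i := congrArg Subtype.val h.1
            omega
        exact ⟨hv.commute _ _ (hne _), hv.commute _ _ (hne _)⟩
      have h := hle (StarSubalgebra.mem_top (x := a))
      rw [StarSubalgebra.mem_comap, StarSubalgebra.mem_centralizer_iff] at h
      exact (h _ rfl).1
    refine ⟨extend φ (matrixUnit (v (K, false)) (v (K, true)))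
      (matrixUnit_mul (hsq _) (hsq _) hanti) (star_matrixUnit hanti (hv.star_eq _) (hv.star_eq _))
      matrixUnit_add (fun s t a => matrixUnit_comm (hcomm _ a) (hcomm _ a) s t), fun i hi s => ?_⟩
    rcases Nat.lt_or_ge i k with h | h
    · rw [← diagEmb_diagEmb h k.le_succ, extend_diagEmb, hφ]
    · obtain rfl : i = k := by omega
      rw [diagEmb_self]
      cases s
      · rw [pauli, if_neg (by simp), map_sub, extend_unitBlock, extend_unitBlock, matrixUnit_sub]
      · rw [pauli, if_pos rfl, map_add, extend_unitBlock, extend_unitBlock, matrixUnit_add_swap]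

theorem exists_isUniversalCCR_matrix.{w} (k : ℕ) :
    ∃ u : ENat.Below k × Bool → Matrix (Fin (2 ^ k)) (Fin (2 ^ k)) ℂ,
      SimpleGraph.IsUniversalCCR.{w} (SimpleGraph.pairGraph (ENat.Below k)) u := by
  refine ⟨_, isCCRFamily_pauli (m := k) (fun i hi => diagEmb i k (by exact_mod_cast hi))
    fun i j hij hi hj a => diagEmb_diagEmb _ _ _, ?_, fun A _ v hv => ?_⟩
  · have h := adjoin_pauli k
    convert dense_univ
    rw [← StarSubalgebra.coe_top (R := ℂ), ← h]
    congr 2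
    ext a
    constructor
    · rintro ⟨⟨i, s⟩, rfl⟩
      exact ⟨i, by exact_mod_cast Order.add_one_le_of_lt i.2, s, rfl⟩
    · rintro ⟨i, hi, s, rfl⟩
      exact ⟨(⟨i, by exact_mod_cast hi⟩, s), rfl⟩
  · obtain ⟨φ, hφ⟩ := exists_lift hv k le_rfl
    exact ⟨φ, fun p => hφ _ _ _⟩

/-- The embedding of `M_{2^k}(ℂ)` into the algebraic direct limit. -/
noncomputable def toLimit (k : ℕ) :
    Matrix (Fin (2 ^ k)) (Fin (2 ^ k)) ℂ →⋆ₐ[ℂ] LocalMatrixAlgebra :=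
  { DirectLimit.Algebra.of (fun k : ℕ => Matrix (Fin (2 ^ k)) (Fin (2 ^ k)) ℂ)
      (fun i j h => diagEmb i j h) k with
    map_star' := fun _ => (DirectLimit.star_def ..).symm }

theorem toLimit_diagEmb (i j : ℕ) (hij : i ≤ j) (a : Matrix (Fin (2 ^ i)) (Fin (2 ^ i)) ℂ) :
    toLimit j (diagEmb i j hij a) = toLimit i a := by
  change (⟦⟨j, diagEmb i j hij a⟩⟧ : LocalMatrixAlgebra) = ⟦⟨i, a⟩⟧
  exact (DirectLimit.eq_of_le (f := fun i j h => diagEmb i j h) ⟨i, a⟩ j hij).symm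

theorem exists_lift_limit {A : Type*} [Ring A] [StarRing A] [Algebra ℂ A]
    (φ : ∀ k : ℕ, Matrix (Fin (2 ^ k)) (Fin (2 ^ k)) ℂ →⋆ₐ[ℂ] A)
    (hφ : ∀ i j hij a, φ j (diagEmb i j hij a) = φ i a) :
    ∃ Φ : LocalMatrixAlgebra →⋆ₐ[ℂ] A, ∀ k a, Φ (toLimit k a) = φ k a := by
  let f : LocalMatrixAlgebra →ₐ[ℂ] A := DirectLimit.Algebra.lift
    (fun k : ℕ => Matrix (Fin (2 ^ k)) (Fin (2 ^ k)) ℂ) (fun i j h => diagEmb i j h)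
    A (fun k => (φ k).toAlgHom) hφ
  have hf (k a) : f (toLimit k a) = φ k a := rfl
  refine ⟨{ f with
    map_star' := fun a => ?_ }, hf⟩
  change f (star a) = star (f a)
  induction a using DirectLimit.induction with
  | _ k a =>
  change f (star (toLimit k a)) = star (f (toLimit k a))
  rw [← map_star, hf, hf, map_star]

/-- Homomorphisms on the finite levels glue to the algebraic limit, and any homomorphism from there
to a C⋆-algebra extends to the completion because the norm is the largest C⋆-seminorm. -/
theorem exists_isUniversalCCR_carAlgebra.{w} :
    ∃ u : ENat.Below ⊤ × Bool → CARAlgebra,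
      SimpleGraph.IsUniversalCCR.{w} (SimpleGraph.pairGraph (ENat.Below ⊤)) u := by
  set p := CStarSeminorm.sup Set.univ bddAbove_localMatrixAlgebra with hp
  refine ⟨_, (isCCRFamily_pauli (m := ⊤) (fun k _ => toLimit k)
    fun i j hij _ _ a => toLimit_diagEmb i j hij a).map p.toCompletion, ?_, fun A _ v hv => ?_⟩
  · have h : StarAlgebra.adjoin ℂ
        (Set.range fun q : ENat.Below ⊤ × Bool => toLimit (q.1 + 1) (pauli q.1 q.2)) = ⊤ := by
      refine StarSubalgebra.eq_top_iff.mpr fun a => ?_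
      induction a using DirectLimit.induction with
      | _ k a =>
      change toLimit k a ∈ _
      have hle : (⊤ : StarSubalgebra ℂ _) ≤ (StarAlgebra.adjoin ℂ (Set.range
          fun q : ENat.Below ⊤ × Bool => toLimit (q.1 + 1) (pauli q.1 q.2))).comap (toLimit k) := by
        rw [← adjoin_pauli k]
        refine StarAlgebra.adjoin_le ?_
        rintro _ ⟨i, hi, s, rfl⟩
        refine StarAlgebra.subset_adjoin ℂ _ ⟨(⟨i, ENat.natCast_lt_top i⟩, s), ?_⟩
        exact (toLimit_diagEmb _ _ _ _).symm
      exact hle StarSubalgebra.mem_top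
    have h2 := p.dense_adjoin_toCompletion h
    rwa [← Set.range_comp] at h2
  · choose φ hφ using fun k : ℕ => exists_lift hv k le_top
    obtain ⟨Φ, hΦ⟩ := exists_lift_limit φ fun i j hij => by
      -- The homomorphisms were chosen separately at each level; they are compatible because they
      -- agree on the Pauli matrices, which generate.
      have : (φ j).comp (diagEmb i j hij) = φ i := by
        refine StarAlgHom.ext_of_adjoin_eq_top (adjoin_pauli i) ?_
        rintro _ ⟨l, hl, s, rfl⟩
        rw [StarAlgHom.comp_apply, diagEmb_diagEmb, hφ, hφ]
      exact fun a => DFunLike.congr_fun this a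
    have hle := CStarSeminorm.le_sup bddAbove_localMatrixAlgebra
      (Set.mem_univ (CStarSeminorm.ofHom Φ))
    refine ⟨p.lift Φ hle, fun q => ?_⟩
    refine (CStarSeminorm.lift_toCompletion _ Φ hle _).trans ?_
    rw [hΦ, ← diagEmb_self (pauli q.1 q.2), hφ]

end LocalMatrix

theorem exists_isUniversalCCR_matrixFactor.{w} (m : ℕ∞) :
    ∃ u : ENat.Below m × Bool → MatrixFactor m,
      SimpleGraph.IsUniversalCCR.{w} (SimpleGraph.pairGraph (ENat.Below m)) u := by
  induction m using ENat.recTopCoe with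
  | top => exact LocalMatrix.exists_isUniversalCCR_carAlgebra
  | coe k => exact LocalMatrix.exists_isUniversalCCR_matrix k

/-! ### Symplectic bases over the field with two elements -/

theorem ENat.exists_equiv_below (K : Type*) [Countable K] :
    ∃ m : ℕ∞, Nonempty (K ≃ ENat.Below m) := by
  cases finite_or_infinite K
  · obtain ⟨k, ⟨e⟩⟩ := Finite.exists_equiv_fin K
    obtain ⟨e'⟩ := ENat.below_coe_equiv_fin k
    exact ⟨k, ⟨e.trans e'.symm⟩⟩
  · obtain ⟨e⟩ := nonempty_equiv_of_countable (α := K) (β := ℕ)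
    exact ⟨⊤, ⟨e.trans ((Equiv.subtypeEquivRight fun i => by simp).trans
      (Equiv.Set.univ ℕ)).symm⟩⟩

theorem ZMod.eq_one_of_ne_zero_two {a : ZMod 2} (h : a ≠ 0) : a = 1 := by
  revert a
  decide

namespace SymplecticBasis

variable {W : Type*} [AddCommGroup W] [Module (ZMod 2) W] {b : W →ₗ[ZMod 2] W →ₗ[ZMod 2] ZMod 2}

theorem symm (hb : b.IsAlt) (x y : W) : b x y = b y x := by
  rw [← hb.neg, ZMod.neg_eq_self_mod_two]

open Classical in
/-- A set of mutually orthogonal hyperbolic pairs. -/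
def IsHyperbolic (b : W →ₗ[ZMod 2] W →ₗ[ZMod 2] ZMod 2) (S : Set (Bool → W)) : Prop :=
  ∀ p ∈ S, ∀ q ∈ S, ∀ s t, b (p s) (q t) = if p = q ∧ s ≠ t then 1 else 0

/-- The subspace spanned by a set of pairs. -/
def pairSpan (S : Set (Bool → W)) : Submodule (ZMod 2) W :=
  Submodule.span (ZMod 2) (Set.range fun i : S × Bool => i.1.1 i.2)

theorem mem_pairSpan {S : Set (Bool → W)} {p : Bool → W} (hp : p ∈ S) (s : Bool) :
    p s ∈ pairSpan S :=
  Submodule.subset_span ⟨(⟨p, hp⟩, s), rfl⟩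

theorem pairSpan_mono {S T : Set (Bool → W)} (h : S ⊆ T) : pairSpan S ≤ pairSpan T := by
  refine Submodule.span_le.mpr ?_
  rintro _ ⟨⟨p, s⟩, rfl⟩
  exact mem_pairSpan (h p.2) s

/-- Orthogonal projection off the span of S. Finiteness of S is what makes the projection a finite
sum. -/
theorem IsHyperbolic.exists_orthogonal {S : Finset (Bool → W)} (hS : IsHyperbolic b S) (x : W) :
    ∃ x', x - x' ∈ pairSpan (S : Set (Bool → W)) ∧ ∀ q ∈ S, ∀ t, b x' (q t) = 0 := by
  classical
  -- Within a hyperbolic pair, the vector dual to `p s` is its partner `p (!s)`, which therefore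
  -- carries the coefficient `b x (p s)`.
  refine ⟨x - ∑ p ∈ S, ∑ s, b x (p s) • p (!s), ?_, fun q hq t => ?_⟩
  · rw [sub_sub_cancel]
    exact sum_mem fun p hp => sum_mem fun s _ => Submodule.smul_mem _ _ (mem_pairSpan hp _)
  · have h : ∀ p ∈ S, ∑ s, b x (p s) * b (p (!s)) (q t) = if p = q then b x (q t) else 0 := by
      intro p hp
      simp only [hS p hp q hq, Fintype.sum_bool]
      by_cases hpq : p = q
      · subst hpq
        cases t <;> simp
      · simp [hpq]
    simp only [map_sub, map_sum, map_smul, LinearMap.sub_apply, LinearMap.sum_apply,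
      LinearMap.smul_apply, smul_eq_mul]
    rw [Finset.sum_congr rfl h, Finset.sum_ite_eq' S q, if_pos hq, sub_self]

theorem eq_zero_of_mem_pairSpan {S : Set (Bool → W)} {x y : W}
    (h : ∀ q ∈ S, ∀ t, b x (q t) = 0) (hy : y ∈ pairSpan S) : b x y = 0 := by
  have : pairSpan S ≤ LinearMap.ker (b x) := by
    refine Submodule.span_le.mpr ?_
    rintro _ ⟨⟨p, s⟩, rfl⟩
    exact h p p.2 s
  exact this hy

/-- One step of symplectic Gram–Schmidt. Remove from x its component along S; if the remainder x' is
not in the radical, some y pairs nontrivially with it, and x' with the corrected y' is a new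
hyperbolic pair. -/
theorem IsHyperbolic.exists_extension (hb : b.IsAlt) {S : Finset (Bool → W)}
    (hS : IsHyperbolic b S) (x : W) :
    ∃ S' : Finset (Bool → W), IsHyperbolic b S' ∧ S ⊆ S' ∧
      x ∈ pairSpan (S' : Set (Bool → W)) ⊔ LinearMap.ker b := by
  classical
  obtain ⟨x', hx', hx0⟩ := hS.exists_orthogonal x
  by_cases hker : x' ∈ LinearMap.ker b
  · refine ⟨S, hS, subset_rfl, ?_⟩
    rw [← sub_add_cancel x x']
    exact Submodule.add_mem_sup hx' hker
  · obtain ⟨y, hy⟩ : ∃ y, b x' y ≠ 0 := by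
      by_contra! h
      exact hker (LinearMap.ext h)
    obtain ⟨y', hy', hy0⟩ := hS.exists_orthogonal y
    -- Correcting y changes it by a vector of the span of S, which is orthogonal to x'; the nonzero
    -- value can only be 1.
    have hxy : b x' y' = 1 := by
      have := eq_zero_of_mem_pairSpan hx0 hy'
      rw [map_sub, sub_eq_zero] at this
      rw [← this]
      exact ZMod.eq_one_of_ne_zero_two hy
    let r : Bool → W := fun s => if s then y' else x'
    have hr0 : ∀ q ∈ S, ∀ s t, b (r s) (q t) = 0 := fun q hq s t => by
      cases s
      · exact hx0 q hq t
      · exact hy0 q hq t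
    have hrS : ∀ q ∈ S, r ≠ q := by
      rintro _ hq rfl
      exact zero_ne_one ((hx0 r hq true).symm.trans hxy)
    refine ⟨insert r S, ?_, Finset.subset_insert r S, ?_⟩
    · intro p hp q hq s t
      rcases Finset.mem_insert.mp hp with rfl | hp <;> rcases Finset.mem_insert.mp hq with rfl | hq
      · cases s <;> cases t <;> simp [r, hb x', hb y', hxy]
        rw [symm hb, hxy]
      · rw [hr0 q hq, if_neg fun h => hrS q hq h.1]
      · rw [symm hb, hr0 p hp, if_neg fun h => hrS p hp h.1.symm]
      · exact hS p hp q hq s t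
    · rw [← sub_add_cancel x x']
      refine Submodule.mem_sup_left (add_mem (pairSpan_mono ?_ hx') ?_)
      · exact Finset.coe_subset.mpr (Finset.subset_insert r S)
      · exact mem_pairSpan (p := r) (Finset.mem_coe.mpr (Finset.mem_insert_self r S)) false

/-- An enumeration of W absorbs the vectors one at a time, keeping every stage finite. A maximal
hyperbolic set from Zorn's lemma would not do: a vector may pair nontrivially with infinitely many
pairs, and then it has no projection. -/
theorem exists_isHyperbolic_sup_ker [Countable W] (hb : b.IsAlt) :
    ∃ T : Set (Bool → W), IsHyperbolic b T ∧ T.Countable ∧ pairSpan T ⊔ LinearMap.ker b = ⊤ := by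
  obtain ⟨w, hw⟩ := exists_surjective_nat W
  choose f hf1 hf2 hf3 using fun (S : {S : Finset (Bool → W) // IsHyperbolic b S}) (x : W) =>
    S.2.exists_extension hb x
  let S : ℕ → {S : Finset (Bool → W) // IsHyperbolic b S} := fun n =>
    Nat.rec ⟨∅, fun p hp => by simp at hp⟩ (fun n S => ⟨f S (w n), hf1 S (w n)⟩) n
  have hmono : Monotone fun n => (S n).1 := monotone_nat_of_le_succ fun n => hf2 (S n) (w n)
  refine ⟨⋃ n, (S n).1, fun p hp q hq s t => ?_,
    Set.countable_iUnion fun n => (S n).1.countable_toSet, ?_⟩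
  · obtain ⟨i, hi⟩ := Set.mem_iUnion.mp hp
    obtain ⟨j, hj⟩ := Set.mem_iUnion.mp hq
    exact (S (max i j)).2 p (hmono (le_max_left i j) hi) q (hmono (le_max_right i j) hj) s t
  · refine eq_top_iff.mpr fun x _ => ?_
    obtain ⟨n, rfl⟩ := hw x
    have h : ((S (n + 1)).1 : Set (Bool → W)) ⊆ ⋃ n, (S n).1 :=
      Set.subset_iUnion (fun n => ((S n).1 : Set (Bool → W))) (n + 1)
    exact sup_le_sup_right (pairSpan_mono h) _ (hf3 (S n) (w n))

/-- Pairing with the partner vector reads off a coefficient. Both the independence of the hyperbolic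
vectors and their independence from the radical follow. -/
theorem IsHyperbolic.apply_linearCombination {T : Set (Bool → W)} (hT : IsHyperbolic b T)
    (p : T) (s : Bool) (l : T × Bool →₀ ZMod 2) :
    b (p.1 (!s)) (Finsupp.linearCombination (ZMod 2) (fun i : T × Bool => i.1.1 i.2) l) =
      l (p, s) := by
  have : b (p.1 (!s)) ∘ₗ Finsupp.linearCombination (ZMod 2) (fun i : T × Bool => i.1.1 i.2) =
      Finsupp.lapply (p, s) := by
    classical
    ext ⟨q, t⟩
    simp only [LinearMap.comp_apply, Finsupp.lsingle_apply, Finsupp.linearCombination_single,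
      one_smul, Finsupp.lapply_apply, hT p p.2 q q.2, Finsupp.single_apply, Prod.mk.injEq]
    refine if_congr ?_ rfl rfl
    rw [Subtype.ext_iff]
    cases s <;> cases t <;> simp [eq_comm]
  exact LinearMap.congr_fun this l

theorem IsHyperbolic.exists_basis (hb : b.IsAlt) {T : Set (Bool → W)} (hT : IsHyperbolic b T)
    (htop : pairSpan T ⊔ LinearMap.ker b = ⊤) {J : Type*}
    (R : Module.Basis J (ZMod 2) (LinearMap.ker b)) :
    ∃ B : Module.Basis (T × Bool ⊕ J) (ZMod 2) W,
      (∀ i, B (Sum.inl i) = i.1.1 i.2) ∧ ∀ j, b (B (Sum.inr j)) = 0 := by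
  let v : T × Bool → W := fun i => i.1.1 i.2
  let z : J → W := fun j => R j
  have hz : Submodule.span (ZMod 2) (Set.range z) = LinearMap.ker b := by
    have : Set.range z = (LinearMap.ker b).subtype '' Set.range R := by
      rw [← Set.range_comp]
      rfl
    rw [this, Submodule.span_image, R.span_eq, Submodule.map_top, Submodule.range_subtype]
  have hv : LinearIndependent (ZMod 2) v := by
    refine linearIndependent_iff.mpr fun l hl => ?_
    ext ⟨p, s⟩
    rw [← hT.apply_linearCombination, hl, map_zero]
    rfl
  have hzi : LinearIndependent (ZMod 2) z := R.linearIndependent.map' _ (Submodule.ker_subtype _)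
  have hdisj : Disjoint (Submodule.span (ZMod 2) (Set.range v))
      (Submodule.span (ZMod 2) (Set.range z)) := by
    rw [hz, Submodule.disjoint_def]
    intro x hx hxk
    obtain ⟨l, rfl⟩ := (Finsupp.mem_span_range_iff_exists_finsupp).mp hx
    -- A combination lying in the radical pairs to zero with every vector, so all its coefficients
    -- vanish.
    have hl : l = 0 := by
      ext ⟨p, s⟩
      rw [← hT.apply_linearCombination, symm hb]
      exact LinearMap.congr_fun hxk _
    rw [hl, Finsupp.sum_zero_index]
  have hspan : ⊤ ≤ Submodule.span (ZMod 2) (Set.range (Sum.elim v z)) := by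
    rw [Set.Sum.elim_range, Submodule.span_union, hz]
    exact htop.ge
  refine ⟨Module.Basis.mk (hv.sum_type hzi hdisj) hspan, fun i => ?_, fun j => ?_⟩
  · rw [Module.Basis.mk_apply, Sum.elim_inl]
  · rw [Module.Basis.mk_apply, Sum.elim_inr]
    exact (R j).2

open Classical in
theorem exists_basis [Countable W] (hb : b.IsAlt) :
    ∃ (m n : ℕ∞) (B : Module.Basis (ENat.Below m × Bool ⊕ ENat.Below n) (ZMod 2) W),
      ∀ i j, b (B i) (B j) = if (SimpleGraph.pairGraph (ENat.Below m) ⊕g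
        (⊥ : SimpleGraph (ENat.Below n))).Adj i j then 1 else 0 := by
  obtain ⟨T, hT, hTc, htop⟩ := exists_isHyperbolic_sup_ker hb
  have : Countable T := hTc
  let R := Module.Basis.ofVectorSpace (ZMod 2) (LinearMap.ker b)
  obtain ⟨B, hB1, hB2⟩ := hT.exists_basis hb htop R
  obtain ⟨m, ⟨e⟩⟩ := ENat.exists_equiv_below T
  obtain ⟨n, ⟨e'⟩⟩ := ENat.exists_equiv_below
    (Module.Basis.ofVectorSpaceIndex (ZMod 2) (LinearMap.ker b))
  let B' := B.reindex ((e.prodCongr (Equiv.refl Bool)).sumCongr e')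
  have h1 (i s) : B' (Sum.inl (i, s)) = (e.symm i).1 s := by
    rw [B.reindex_apply]
    exact hB1 (e.symm i, s)
  have h2 (j) : b (B' (Sum.inr j)) = 0 := by
    rw [B.reindex_apply]
    exact hB2 (e'.symm j)
  refine ⟨m, n, B', ?_⟩
  rintro (⟨i, s⟩ | i) (⟨j, t⟩ | j)
  · rw [h1, h1, hT _ (e.symm i).2 _ (e.symm j).2 s t]
    refine if_congr ?_ rfl rfl
    rw [← Subtype.ext_iff, e.symm.injective.eq_iff]
    rfl
  · rw [symm hb, h2, LinearMap.zero_apply, if_neg (by simp)]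
  · rw [h2, LinearMap.zero_apply, if_neg (by simp)]
  · rw [h2, LinearMap.zero_apply, if_neg (by simp)]

end SymplecticBasis

/-! ### The adjacency form of a graph and its normal form -/

namespace SimpleGraph

variable {V : Type*} (G : SimpleGraph V)

open Classical in
/-- The alternating form over the field with two elements defined by the adjacency matrix. -/
noncomputable def adjForm : (V →₀ ZMod 2) →ₗ[ZMod 2] (V →₀ ZMod 2) →ₗ[ZMod 2] ZMod 2 :=
  Finsupp.linearCombination (ZMod 2) fun x => Finsupp.linearCombination (ZMod 2) fun y =>
    if G.Adj x y then 1 else 0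

open Classical in
theorem adjForm_single (x y : V) :
    G.adjForm (Finsupp.single x 1) (Finsupp.single y 1) = if G.Adj x y then 1 else 0 := by
  simp [adjForm]

theorem adjForm_symm (x y : V →₀ ZMod 2) : G.adjForm x y = G.adjForm y x := by
  have : G.adjForm = G.adjForm.flip := by
    classical
    ext x y
    simp only [LinearMap.comp_apply, Finsupp.lsingle_apply, LinearMap.flip_apply, adjForm_single]
    exact if_congr (G.adj_comm x y) rfl rfl
  exact LinearMap.congr_fun (LinearMap.congr_fun this x) y

theorem isAlt_adjForm : G.adjForm.IsAlt := by
  intro x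
  induction x using Finsupp.induction_linear with
  | zero => simp
  | add x y hx hy =>
    simp only [map_add, LinearMap.add_apply]
    rw [hx, hy, G.adjForm_symm y x, zero_add,
      add_zero, CharTwo.add_self_eq_zero]
  | single x a =>
    rw [← mul_one a, ← smul_eq_mul, ← Finsupp.smul_single, map_smul, map_smul,
      LinearMap.smul_apply, adjForm_single, if_neg (G.irrefl), smul_zero, smul_zero]

/-- Taking coordinates in a symplectic basis is an isometry, since the Gram matrix of that basis is
the adjacency matrix of the model graph. -/
theorem exists_linearEquiv_adjForm [Countable V] :
    ∃ (m n : ℕ∞) (Θ : (V →₀ ZMod 2) ≃ₗ[ZMod 2] (ENat.Below m × Bool ⊕ ENat.Below n →₀ ZMod 2)),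
      ∀ x y, (pairGraph (ENat.Below m) ⊕g (⊥ : SimpleGraph (ENat.Below n))).adjForm (Θ x) (Θ y) =
        G.adjForm x y := by
  obtain ⟨m, n, B, hB⟩ := SymplecticBasis.exists_basis G.isAlt_adjForm
  refine ⟨m, n, B.repr, fun x y => ?_⟩
  have : (pairGraph (ENat.Below m) ⊕g (⊥ : SimpleGraph (ENat.Below n))).adjForm.compl₁₂
      B.repr.toLinearMap B.repr.toLinearMap = G.adjForm := by
    refine B.ext fun i => B.ext fun j => ?_
    rw [LinearMap.compl₁₂_apply, LinearEquiv.coe_coe, B.repr_self, B.repr_self, adjForm_single, hB]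
  exact LinearMap.congr_fun (LinearMap.congr_fun this x) y

end SimpleGraph

/-! ### Monomials in the generators -/

namespace SimpleGraph

/-- The sign `(-1) ^ a`. -/
def parity (a : ZMod 2) : ℂ := if a = 0 then 1 else -1

theorem parity_add (a b : ZMod 2) : parity (a + b) = parity a * parity b := by
  have h (a : ZMod 2) : a = 0 ∨ a = 1 := by revert a; decide
  have h2 : (1 : ZMod 2) + 1 = 0 := by decide
  rcases h a with rfl | rfl <;> rcases h b with rfl | rfl <;> simp [parity, h2]

theorem parity_eq_or (a : ZMod 2) : parity a = 1 ∨ parity a = -1 := by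
  rw [parity]
  split_ifs <;> simp

/-- The exponent vector of a word. -/
noncomputable def wordWeight {V : Type*} (l : List V) : V →₀ ZMod 2 :=
  (l.map fun x => Finsupp.single x 1).sum

section wordWeight

variable {V : Type*}

theorem wordWeight_cons (x : V) (l : List V) :
    wordWeight (x :: l) = Finsupp.single x 1 + wordWeight l := by
  simp [wordWeight]

theorem wordWeight_append (l l' : List V) :
    wordWeight (l ++ l') = wordWeight l + wordWeight l' := by
  simp [wordWeight]

theorem finsupp_add_self (w : V →₀ ZMod 2) : w + w = 0 := by
  ext x
  exact CharTwo.add_self_eq_zero (w x)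

theorem wordWeight_surjective (w : V →₀ ZMod 2) : ∃ l, wordWeight l = w := by
  induction w using Finsupp.induction_linear with
  | zero => exact ⟨[], rfl⟩
  | add w w' h h' =>
    obtain ⟨l, rfl⟩ := h
    obtain ⟨l', rfl⟩ := h'
    exact ⟨l ++ l', wordWeight_append l l'⟩
  | single x a =>
    by_cases h : a = 0
    · exact ⟨[], by rw [h, Finsupp.single_zero]; rfl⟩
    · exact ⟨[x], by rw [ZMod.eq_one_of_ne_zero_two h]; simp [wordWeight]⟩

theorem wordWeight_apply_of_notMem {x : V} {l : List V} (h : x ∉ l) : wordWeight l x = 0 := by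
  induction l with
  | nil => rfl
  | cons y l ih =>
    rw [List.mem_cons, not_or] at h
    rw [wordWeight_cons, Finsupp.add_apply, ih h.2, Finsupp.single_eq_of_ne h.1, add_zero]

end wordWeight

variable {V : Type*} {G : SimpleGraph V} {A : Type*} [Ring A] [Algebra ℂ A] {u : V → A}

/-- `a` is a scalar multiple of a product of generators with exponent vector `w`. -/
def IsMonomial (u : V → A) (w : V →₀ ZMod 2) (a : A) : Prop :=
  ∃ (l : List V) (c : ℂ), wordWeight l = w ∧ a = c • (l.map u).prod

theorem IsMonomial.mul {w w' : V →₀ ZMod 2} {a a' : A} (h : IsMonomial u w a)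
    (h' : IsMonomial u w' a') : IsMonomial u (w + w') (a * a') := by
  obtain ⟨l, c, rfl, rfl⟩ := h
  obtain ⟨l', c', rfl, rfl⟩ := h'
  exact ⟨l ++ l', c * c', wordWeight_append l l', by
    rw [List.map_append, List.prod_append, smul_mul_smul_comm]⟩

variable [StarRing A]

theorem IsCCRFamily.mul_comm_parity (hu : G.IsCCRFamily u) (x y : V) : u x * u y =
    parity (G.adjForm (Finsupp.single x 1) (Finsupp.single y 1)) • (u y * u x) := by
  classical
  rw [adjForm_single]
  by_cases h : G.Adj x y
  · rw [if_pos h, parity, if_neg one_ne_zero, neg_one_smul]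
    exact hu.anticommute x y h
  · rw [if_neg h, parity, if_pos rfl, one_smul]
    exact hu.commute x y h

theorem IsCCRFamily.mul_prod_parity (hu : G.IsCCRFamily u) (x : V) (l : List V) :
    u x * (l.map u).prod =
      parity (G.adjForm (Finsupp.single x 1) (wordWeight l)) • ((l.map u).prod * u x) := by
  induction l with
  | nil => simp [wordWeight, parity]
  | cons y l ih =>
    rw [List.map_cons, List.prod_cons, ← mul_assoc, hu.mul_comm_parity, smul_mul_assoc, mul_assoc,
      ih, mul_smul_comm, smul_smul, wordWeight_cons, map_add, parity_add, mul_assoc]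

/-- Interchanging two words collects one sign for each pair of letters, and the total is biadditive
in the exponent vectors. -/
theorem IsCCRFamily.prod_mul_prod_parity (hu : G.IsCCRFamily u) (l l' : List V) :
    (l.map u).prod * (l'.map u).prod =
      parity (G.adjForm (wordWeight l) (wordWeight l')) • ((l'.map u).prod * (l.map u).prod) := by
  induction l with
  | nil => simp [wordWeight, parity]
  | cons x l ih =>
    rw [List.map_cons, List.prod_cons, mul_assoc, ih, mul_smul_comm, ← mul_assoc,
      hu.mul_prod_parity, smul_mul_assoc, smul_smul, wordWeight_cons, map_add,
      LinearMap.add_apply, parity_add, mul_comm (parity _), mul_assoc]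

/-- If the exponents are all even, the first letter occurs again. Moving it next to that occurrence
costs a sign, the two cancel, and the remaining word is shorter with the same exponent vector. -/
theorem IsCCRFamily.prod_eq_one_or (hu : G.IsCCRFamily u) (l : List V) (hl : wordWeight l = 0) :
    (l.map u).prod = 1 ∨ (l.map u).prod = -1 := by
  induction h : l.length using Nat.strong_induction_on generalizing l with
  | _ n ih =>
  cases l with
  | nil => simp
  | cons x l =>
    have hx : x ∈ l := by
      by_contra hx
      have := DFunLike.congr_fun hl x
      rw [wordWeight_cons, Finsupp.add_apply, wordWeight_apply_of_notMem hx,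
        Finsupp.single_eq_same] at this
      exact one_ne_zero this
    obtain ⟨l₁, l₂, rfl⟩ := List.append_of_mem hx
    have hw : wordWeight (l₁ ++ l₂) = 0 := by
      rw [wordWeight_cons, wordWeight_append, wordWeight_cons, add_left_comm (wordWeight l₁),
        ← add_assoc, finsupp_add_self, zero_add, ← wordWeight_append] at hl
      exact hl
    have hlen : (l₁ ++ l₂).length < n := by
      rw [← h]
      simp
    have hp : ((x :: (l₁ ++ x :: l₂)).map u).prod =
        parity (G.adjForm (Finsupp.single x 1) (wordWeight l₁)) • ((l₁ ++ l₂).map u).prod := by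
      rw [List.map_cons, List.prod_cons, List.map_append, List.prod_append, List.map_cons,
        List.prod_cons, ← mul_assoc, hu.mul_prod_parity, smul_mul_assoc, mul_assoc,
        ← mul_assoc (u x), ← sq, hu.sq_eq_one, one_mul, List.map_append, List.prod_append]
    rw [hp]
    rcases ih _ hlen _ hw rfl with h1 | h1 <;>
      rcases parity_eq_or (G.adjForm (Finsupp.single x 1) (wordWeight l₁)) with h2 | h2 <;>
      rw [h1, h2] <;> simp

theorem IsMonomial.map {W : Type*} {B : Type*} [Ring B] [StarRing B] [Algebra ℂ B] {v : W → B}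
    (φ : A →⋆ₐ[ℂ] B) (Θ : (V →₀ ZMod 2) →ₗ[ZMod 2] (W →₀ ZMod 2))
    (hφ : ∀ x, IsMonomial v (Θ (Finsupp.single x 1)) (φ (u x))) {w : V →₀ ZMod 2} {a : A}
    (h : IsMonomial u w a) : IsMonomial v (Θ w) (φ a) := by
  obtain ⟨l, c, rfl, rfl⟩ := h
  have key : IsMonomial v (Θ (wordWeight l)) (φ (l.map u).prod) := by
    induction l with
    | nil => exact ⟨[], 1, by simp [wordWeight], by simp⟩
    | cons x l ih =>
      rw [wordWeight_cons, map_add, List.map_cons, List.prod_cons, map_mul]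
      exact (hφ x).mul ih
  obtain ⟨l', c', h1, h2⟩ := key
  exact ⟨l', c * c', h1, by rw [map_smul, h2, smul_smul]⟩

theorem IsMonomial.mul_comm_parity (hu : G.IsCCRFamily u) {w w' : V →₀ ZMod 2} {a a' : A}
    (h : IsMonomial u w a) (h' : IsMonomial u w' a') :
    a * a' = parity (G.adjForm w w') • (a' * a) := by
  obtain ⟨l, c, rfl, rfl⟩ := h
  obtain ⟨l', c', rfl, rfl⟩ := h'
  rw [smul_mul_smul_comm, hu.prod_mul_prod_parity, smul_mul_smul_comm, smul_comm, mul_comm c]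

/-- Appending the letter x makes the exponent vector zero, so the product becomes 1 or -1;
multiplying by `u x` once more undoes the appending. -/
theorem IsMonomial.eq_smul (hu : G.IsCCRFamily u) {x : V} {a : A}
    (h : IsMonomial u (Finsupp.single x 1) a) : ∃ c : ℂ, a = c • u x := by
  obtain ⟨l, c, hl, rfl⟩ := h
  have hw : wordWeight (l ++ [x]) = 0 := by
    rw [wordWeight_append, hl, wordWeight_cons, ← add_assoc, finsupp_add_self, zero_add]
    rfl
  have h1 : (l.map u).prod = ((l ++ [x]).map u).prod * u x := by
    rw [List.map_append, List.prod_append, mul_assoc]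
    simp [← sq, hu.sq_eq_one]
  rcases hu.prod_eq_one_or _ hw with h2 | h2
  · exact ⟨c, by rw [h1, h2, one_mul]⟩
  · exact ⟨-c, by rw [h1, h2, neg_one_mul, smul_neg, neg_smul]⟩

/-- A word is unitary, and its square has exponent zero, hence is 1 or -1. -/
theorem IsCCRFamily.exists_symmetry [StarModule ℂ A] (hu : G.IsCCRFamily u) (w : V →₀ ZMod 2) :
    ∃ a, IsMonomial u w a ∧ a ∈ _root_.unitary A ∧ a ^ 2 = 1 := by
  obtain ⟨l, rfl⟩ := wordWeight_surjective w
  have hl : (l.map u).prod ∈ _root_.unitary A := by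
    refine list_prod_mem fun a ha => ?_
    obtain ⟨x, _, rfl⟩ := List.mem_map.mp ha
    exact hu.unitary x
  have h := hu.prod_eq_one_or (l ++ l) (by rw [wordWeight_append, finsupp_add_self])
  rw [List.map_append, List.prod_append] at h
  rcases h with h | h
  · exact ⟨_, ⟨l, 1, rfl, (one_smul ..).symm⟩, hl, by rw [sq, h]⟩
  -- When the square is -1, multiplication by i corrects it and preserves unitarity.
  · refine ⟨Complex.I • (l.map u).prod, ⟨l, _, rfl, rfl⟩, ?_, ?_⟩
    · obtain ⟨h1, h2⟩ := Unitary.mem_iff.mp hl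
      rw [Unitary.mem_iff, star_smul, smul_mul_smul_comm, smul_mul_smul_comm, h1, h2]
      simp
    · rw [sq, smul_mul_smul_comm, h, Complex.I_mul_I, neg_one_smul, neg_neg]

/-- Commutation signs depend only on the form, so symmetries with exponents Θ(e_x) satisfy the
relations of H whenever Θ preserves the forms. -/
theorem IsCCRFamily.exists_of_linearMap [StarModule ℂ A] (hu : G.IsCCRFamily u) {W : Type*}
    (H : SimpleGraph W) (Θ : (W →₀ ZMod 2) →ₗ[ZMod 2] (V →₀ ZMod 2))
    (hΘ : ∀ x y, G.adjForm (Θ x) (Θ y) = H.adjForm x y) :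
    ∃ v : W → A, H.IsCCRFamily v ∧ ∀ x, IsMonomial u (Θ (Finsupp.single x 1)) (v x) := by
  classical
  choose v hv1 hv2 hv3 using fun x : W => hu.exists_symmetry (Θ (Finsupp.single x 1))
  refine ⟨v, ⟨hv2, hv3, fun x y h => ?_, fun x y h => ?_⟩, hv1⟩
  · rw [(hv1 x).mul_comm_parity hu (hv1 y), hΘ, adjForm_single, if_neg h, parity, if_pos rfl,
      one_smul]
  · rw [(hv1 x).mul_comm_parity hu (hv1 y), hΘ, adjForm_single, if_pos h, parity,
      if_neg one_ne_zero, neg_one_smul]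

/-! ### Isometric forms give isomorphic algebras -/

namespace IsUniversalCCR

/-- Such a θ sends `u x` to `c • u x`, and applying θ to `u x ^ 2 = 1` gives `(c * c) • 1 = 1`; a
second application of θ therefore restores `u x`. -/
theorem comp_self_eq_id.{w, v, u} {V : Type v} {G : SimpleGraph V} {B : Type u} [CStarAlgebra B]
    {u : V → B} (hu : IsUniversalCCR.{w} G u) (θ : B →⋆ₐ[ℂ] B)
    (hθ : ∀ x, IsMonomial u (Finsupp.single x 1) (θ (u x))) : θ.comp θ = StarAlgHom.id ℂ B := by
  refine StarAlgHom.ext_of_dense hu.dense ?_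
  rintro _ ⟨x, rfl⟩
  obtain ⟨c, hc⟩ := (hθ x).eq_smul hu.isCCRFamily
  have h1 : (c * c) • (1 : B) = 1 := by
    have h := congrArg θ (hu.isCCRFamily.sq_eq_one x)
    rwa [map_pow, map_one, hc, sq, smul_mul_smul_comm, ← sq (u x),
      hu.isCCRFamily.sq_eq_one] at h
  rw [StarAlgHom.comp_apply, hc, map_smul, hc, smul_smul, ← one_mul (u x), ← smul_mul_assoc, h1]
  rfl

/-- The isometry and its inverse send generators to monomials, so each composite of the induced
homomorphisms fixes generators up to scalars and squares to the identity. Each universal property is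
taken in the universe of the other algebra. -/
theorem nonempty_starAlgEquiv.{v, v', u, u'} {V : Type v} {W : Type v'} {G : SimpleGraph V}
    {H : SimpleGraph W} {B : Type u} {C : Type u'} [CStarAlgebra B] [CStarAlgebra C] {u : V → B}
    {v : W → C} (hu : IsUniversalCCR.{u'} G u) (hv : IsUniversalCCR.{u} H v)
    (Θ : (V →₀ ZMod 2) ≃ₗ[ZMod 2] (W →₀ ZMod 2))
    (hΘ : ∀ x y, H.adjForm (Θ x) (Θ y) = G.adjForm x y) : Nonempty (B ≃⋆ₐ[ℂ] C) := by
  obtain ⟨u', hu', hum⟩ := hv.isCCRFamily.exists_of_linearMap G Θ.toLinearMap hΘ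
  obtain ⟨v', hv', hvm⟩ := hu.isCCRFamily.exists_of_linearMap H Θ.symm.toLinearMap
    fun x y => by simp [← hΘ]
  obtain ⟨φ, hφ⟩ := hu.exists_lift C u' hu'
  obtain ⟨ψ, hψ⟩ := hv.exists_lift B v' hv'
  simp only [← hφ] at hum
  simp only [← hψ] at hvm
  have h1 := hu.comp_self_eq_id (ψ.comp φ) fun x => by
    simpa using (hum x).map ψ _ hvm
  have h2 := hv.comp_self_eq_id (φ.comp ψ) fun x => by
    simpa using (hvm x).map φ _ hum
  -- Since (ψφ)² and (φψ)² are identities, ψφψ is a two-sided inverse of φ, whereas ψ itself inverts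
  -- φ only up to signs on generators.
  exact ⟨StarAlgEquiv.ofBijective φ
    ⟨Function.LeftInverse.injective (g := ψ ∘ φ ∘ ψ) fun b => DFunLike.congr_fun h1 b,
      Function.RightInverse.surjective (g := ψ ∘ φ ∘ ψ) fun c => DFunLike.congr_fun h2 c⟩⟩

end IsUniversalCCR

end SimpleGraph

theorem mainTheorem6 {V : Type*} [Countable V] [Infinite V] (G : SimpleGraph V) :
    ∃ m n : ℕ∞, Nonempty (G.CCRAlgebra ≃⋆ₐ[ℂ] CStarTensor (MatrixFactor m) (CommFactor n)) := by
  obtain ⟨m, n, Θ, hΘ⟩ := G.exists_linearEquiv_adjForm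
  obtain ⟨u, hu⟩ := exists_isUniversalCCR_matrixFactor m
  obtain ⟨v, hv⟩ := exists_isUniversalCCR_commFactor n
  exact ⟨m, n, G.isUniversalCCR_ccrGenerator.nonempty_starAlgEquiv (hu.tensor hv) Θ hΘ⟩
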